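/- Let $I\subseteq\mathbb R$ be an interval with more than one point, possibly unbounded, open, closed or half-open. All integrals $\int_a^b F$ of functions are Henstock--Kurzweil (HK) integrals. HK integrability over $I$ means gauge integrability, over the closure of $I$ in $[-\infty,\infty]$, of the function extended by $0$ outside $I$ and at $\pm\infty$. *Primitives.* Let $\mathcal D^{lr}(I)$ be the space of functions $H:I\to\mathbb R$ that have a left limit at each point of $I$ other than a possible minimum, are HK integrable over $I$, and have a right limit $H(\inf I+)\in\mathbb R$ (where $\inf I\in[-\infty,\infty)$). Let $\mathcal D^{lc}(I)$ be the space of those $G\in\mathcal D^{lr}(I)$ with $G(t-)=G(t)$ for every $t\in I$ that is not the minimum of $I$, and $G(\min I)=G(\min I+)$ if $\min I$ exists. Let $\mathcal D^{lc}_0(I)=\{F\in\mathcal D^{lc}(I): F(\inf I+)=0\}$. Order $\mathcal D^{lc}(I)$ and $\mathcal D^{lc}_0(I)$ pointwise on $I$, and put $$\|F\|_A=\sup_{[a,b]\subseteq I}\Bigl|\int_a^bF(t)\,dt\Bigr| .$$ *Distributions.* Let $\mathcal D$ be the space of $C^\infty$ functions on $\mathbb R$ with compact support contained in $I$. Let $\phi_n\to\phi$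 in $\mathcal D$ mean that the supports of all $\phi_n$ lie in one compact $K\subseteq I$ and that $\phi_n^{(m)}\to\phi^{(m)}$ uniformly for every $m\ge0$. Let $\mathcal D'$ be the space of linear functionals on $\mathcal D$ that are continuous for this convergence. For $f\in\mathcal D'$ and $H\in\mathcal D^{lr}(I)$, call $H$ a primitive of $f$, and write $f=H'$, if $\langle f,\phi\rangle=-\int_a^bH(t)\phi'(t)\,dt$ for all $\phi\in\mathcal D$ and all $[a,b]$ with $\operatorname{supp}\phi'\subseteq[a,b]\subseteq I$. Let $\mathcal A_D(I)$ be the space of all $f\in\mathcal D'$ that have a primitive $H\in\mathcal D^{lr}(I)$ with $H(\inf I+)=0$. An *ordered normed space* is a real vector space with a norm and a partial order such that $x\preceq y$ implies $x+z\preceq y+z$ and $kx\preceq ky$ for all $z$ and all real $k\ge0$, and whose cone $\{x: x\succeq 0\}$ is closed in the norm topology. **Theorem.** (a) The integrals and the supremum defining $\|F\|_A$ exist and are finite for each $F\in\mathcal D^{lc}(I)$, and $\mathcal D^{lc}(I)$ and $\mathcal D^{lc}_0(I)$ are ordered normed spaces with respect to $\|\cdot\|_A$ and the pointwise order. (b)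 If $I$ is bounded above or unbounded below, $\mathcal A_D(I)$ contains every $f\in\mathcal D'$ that has a primitive in $\mathcal D^{lr}(I)$. In general, every $f\in\mathcal A_D(I)$ has exactly one primitive $\mathcal F(f)$ in $\mathcal D^{lc}_0(I)$, and the integral $\int_a^bf:=G(b)-G(a)$ $(a,b\in I)$ does not depend on the choice of the primitive $G\in\mathcal D^{lc}(I)$ of $f$. With the partial order $f\preceq g\iff\mathcal F(f)\le\mathcal F(g)$ and the norm $\|f\|_A=\|\mathcal F(f)\|_A$, $\mathcal A_D(I)$ is an ordered normed space. If $\min I$ exists, then $f\preceq g$ if and only if $\int_{\min I}^xf\le\int_{\min I}^xg$ for each $x\in I$. (c) $\mathcal F$ is a linear bijection of $\mathcal A_D(I)$ onto $\mathcal D^{lc}_0(I)$ that is an isometry and an order isomorphism. It is given by the integral: $\mathcal F(f)(x)=\lim_{a\to\inf I+}\int_a^xf$ for $x\in I$, and $\mathcal F(f)(x)=\int_{\min I}^xf$ if $\min I$ exists. -/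

import Mathlib

open Set Filter Topology BoxIntegral

noncomputable section

namespace LDPrimitive

/-! ### The Henstock–Kurzweil integral -/

/-- The compact interval `[a, b]` as a one-dimensional box. -/
def box (a b : ℝ) (hab : a < b) : Box (Fin 1) :=
  ⟨fun _ => a, fun _ => b, fun _ => hab⟩

/-- `f` is Henstock–Kurzweil integrable on `[a, b]` with integral `y`. -/
def HasHKIntegral (f : ℝ → ℝ) (a b : ℝ) (hab : a < b) (y : ℝ) : Prop :=
  BoxIntegral.HasIntegral (box a b hab) IntegrationParams.Henstock
    (fun x : Fin 1 → ℝ => f (x 0)) BoxAdditiveMap.volume y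

/-- The Henstock–Kurzweil integral of `f` over `[a, b]` (`0` if `f` is not integrable). -/
def hkIntegral (f : ℝ → ℝ) (a b : ℝ) (hab : a < b) : ℝ :=
  BoxIntegral.integral (box a b hab) IntegrationParams.Henstock
    (fun x : Fin 1 → ℝ => f (x 0)) BoxAdditiveMap.volume

/-- The extension by zero to `ℝ` of a function defined on `I`. -/
def zeroExt {I : Set ℝ} (F : I → ℝ) : ℝ → ℝ := Function.extend Subtype.val F 0

/-- The box `J` runs from `inf I` to `sup I`, where an infinite end of `I` is replaced by a point
of the neighbourhood `[-∞, -R]` of `-∞`, respectively `[R, ∞]` of `∞`. -/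
def Spans (I : Set ℝ) (R : ℝ) (J : Box (Fin 1)) : Prop :=
  (BddBelow I → J.lower 0 = sInf I) ∧ (¬ BddBelow I → J.lower 0 ≤ -R) ∧
  (BddAbove I → J.upper 0 = sSup I) ∧ (¬ BddAbove I → R ≤ J.upper 0)

/-- `F : I → ℝ` is Henstock–Kurzweil integrable over the whole of the (possibly unbounded, possibly
not closed) interval `I`, with integral `y`. This is the gauge definition over the closure of `I`
in `[-∞, ∞]`: `F` is extended by zero outside `I`, the extension is `0` at `±∞`, so that the
subinterval tagged at an infinite end contributes nothing to the Riemann sum, and the gauge consists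
of the radii `r` at the finite points and the neighbourhoods `[-∞, -R]` and `[R, ∞]` at `±∞`. -/
def HasHKIntegralOn {I : Set ℝ} (F : I → ℝ) (y : ℝ) : Prop :=
  ∀ ε : ℝ, 0 < ε → ∃ (r : (Fin 1 → ℝ) → Ioi (0 : ℝ)) (R : ℝ), ∀ J : Box (Fin 1), Spans I R J →
    ∀ π : TaggedPrepartition J, π.IsPartition → π.IsHenstock → π.IsSubordinate r →
      |integralSum (fun x : Fin 1 → ℝ => zeroExt F (x 0)) BoxAdditiveMap.volume π - y| ≤ ε

/-- Global Henstock–Kurzweil integrability on `I`. -/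
def HKIntegrableOn {I : Set ℝ} (F : I → ℝ) : Prop := ∃ y, HasHKIntegralOn F y

/-! ### The spaces of primitives -/

/-- The filter describing `t → (inf I)+` within `I`, where `inf I ∈ [-∞, ∞)`. -/
def infRight (I : Set ℝ) : Filter I :=
  comap (fun t : I => ((t : ℝ) : EReal)) (𝓝[>] (⨅ t : I, ((t : ℝ) : EReal)))

/-- `H` has a left limit at each point of `I` other than the possible minimum. -/
def LeftRegulated {I : Set ℝ} (H : I → ℝ) : Prop :=
  ∀ t : I, ¬ IsMin t → ∃ l : ℝ, Tendsto H (𝓝[<] t) (𝓝 l)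

lemma zeroExt_zero {I : Set ℝ} : zeroExt (0 : I → ℝ) = 0 := by
  ext x
  by_cases h : ∃ a : I, a.1 = x
  · obtain ⟨a, rfl⟩ := h
    simp [zeroExt]
  · simp [zeroExt, Function.extend_apply' _ _ _ h]

lemma zeroExt_add {I : Set ℝ} (F G : I → ℝ) : zeroExt (F + G) = zeroExt F + zeroExt G := by
  ext x
  by_cases h : ∃ a : I, a.1 = x
  · obtain ⟨a, rfl⟩ := h
    simp [zeroExt]
  · simp [zeroExt, Function.extend_apply' _ _ _ h]

lemma zeroExt_smul {I : Set ℝ} (c : ℝ) (F : I → ℝ) : zeroExt (c • F) = c • zeroExt F := by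
  ext x
  by_cases h : ∃ a : I, a.1 = x
  · obtain ⟨a, rfl⟩ := h
    simp [zeroExt]
  · simp [zeroExt, Function.extend_apply' _ _ _ h]

lemma Spans.mono {I : Set ℝ} {R R' : ℝ} {J : Box (Fin 1)} (h : R ≤ R') (hJ : Spans I R' J) :
    Spans I R J :=
  ⟨hJ.1, fun h0 => (hJ.2.1 h0).trans (by linarith), hJ.2.2.1, fun h0 => h.trans (hJ.2.2.2 h0)⟩

lemma HKIntegrableOn.zero {I : Set ℝ} : HKIntegrableOn (0 : I → ℝ) := by
  refine ⟨0, fun ε hε => ⟨fun _ => ⟨1, mem_Ioi.2 one_pos⟩, 0, fun J _ π _ _ _ => ?_⟩⟩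
  simp [zeroExt_zero, integralSum, hε.le]

lemma HKIntegrableOn.add {I : Set ℝ} {F G : I → ℝ} (hF : HKIntegrableOn F)
    (hG : HKIntegrableOn G) : HKIntegrableOn (F + G) := by
  obtain ⟨y, hy⟩ := hF
  obtain ⟨z, hz⟩ := hG
  refine ⟨y + z, fun ε hε => ?_⟩
  obtain ⟨r, R, h⟩ := hy (ε / 2) (half_pos hε)
  obtain ⟨r', R', h'⟩ := hz (ε / 2) (half_pos hε)
  refine ⟨fun x => min (r x) (r' x), max R R', fun J hJ π hp hH hs => ?_⟩
  have h1 := h J (hJ.mono (le_max_left _ _)) π hp hH (hs.mono fun x _ => min_le_left _ _)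
  have h2 := h' J (hJ.mono (le_max_right _ _)) π hp hH (hs.mono fun x _ => min_le_right _ _)
  have e : (fun x : Fin 1 → ℝ => zeroExt (F + G) (x 0)) =
      (fun x : Fin 1 → ℝ => zeroExt F (x 0)) + (fun x : Fin 1 → ℝ => zeroExt G (x 0)) := by
    rw [zeroExt_add]; rfl
  rw [e, integralSum_add]
  rw [abs_le] at *
  constructor <;> linarith [h1.1, h1.2, h2.1, h2.2]

lemma HKIntegrableOn.smul {I : Set ℝ} {F : I → ℝ} (c : ℝ) (hF : HKIntegrableOn F) :
    HKIntegrableOn (c • F) := by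
  obtain ⟨y, hy⟩ := hF
  refine ⟨c * y, fun ε hε => ?_⟩
  have hc : 0 < |c| + 1 := by positivity
  obtain ⟨r, R, h⟩ := hy (ε / (|c| + 1)) (div_pos hε hc)
  refine ⟨r, R, fun J hJ π hp hH hs => ?_⟩
  have h1 := h J hJ π hp hH hs
  have e : (fun x : Fin 1 → ℝ => zeroExt (c • F) (x 0)) =
      c • (fun x : Fin 1 → ℝ => zeroExt F (x 0)) := by
    rw [zeroExt_smul]; rfl
  rw [e, integralSum_smul, smul_eq_mul, ← mul_sub, abs_mul]
  calc _ ≤ |c| * (ε / (|c| + 1)) := by gcongr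
    _ ≤ (|c| + 1) * (ε / (|c| + 1)) := by gcongr; linarith
    _ = ε := by field_simp

/-- `𝒟^{lr}(I)`: the left regulated, globally Henstock–Kurzweil integrable functions on `I` with a
right limit at `inf I`. -/
def Dlr (I : Set ℝ) : Submodule ℝ (I → ℝ) where
  carrier := {H | LeftRegulated H ∧ HKIntegrableOn H ∧ ∃ l : ℝ, Tendsto H (infRight I) (𝓝 l)}
  zero_mem' := ⟨fun _ _ => ⟨0, tendsto_const_nhds⟩, HKIntegrableOn.zero, 0, tendsto_const_nhds⟩
  add_mem' := by
    rintro F G ⟨hF, iF, l, hl⟩ ⟨hG, iG, k, hk⟩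
    refine ⟨fun t ht => ?_, iF.add iG, l + k, hl.add hk⟩
    obtain ⟨u, hu⟩ := hF t ht
    obtain ⟨v, hv⟩ := hG t ht
    exact ⟨u + v, hu.add hv⟩
  smul_mem' := by
    rintro c F ⟨hF, iF, l, hl⟩
    refine ⟨fun t ht => ?_, iF.smul c, c • l, hl.const_smul c⟩
    obtain ⟨u, hu⟩ := hF t ht
    exact ⟨c • u, hu.const_smul c⟩

/-- `𝒟^{lc}(I)`: the functions of `𝒟^{lr}(I)` that are left continuous (at the points other than
the possible minimum), and right continuous at the possible minimum. -/
def Dlc (I : Set ℝ) : Submodule ℝ (I → ℝ) where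
  carrier := {G | G ∈ Dlr I ∧ (∀ t : I, ¬ IsMin t → Tendsto G (𝓝[<] t) (𝓝 (G t))) ∧
    ∀ m : I, IsMin m → Tendsto G (𝓝[>] m) (𝓝 (G m))}
  zero_mem' := ⟨zero_mem _, fun _ _ => tendsto_const_nhds, fun _ _ => tendsto_const_nhds⟩
  add_mem' := fun hF hG => ⟨add_mem hF.1 hG.1, fun t ht => (hF.2.1 t ht).add (hG.2.1 t ht),
    fun m hm => (hF.2.2 m hm).add (hG.2.2 m hm)⟩
  smul_mem' := fun c _ hF => ⟨(Dlr I).smul_mem c hF.1, fun t ht => (hF.2.1 t ht).const_smul c,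
    fun m hm => (hF.2.2 m hm).const_smul c⟩

/-- `𝒟^{lc}_0(I)`: the functions of `𝒟^{lc}(I)` whose right limit at `inf I` is `0`. -/
def Dlc0 (I : Set ℝ) : Submodule ℝ (I → ℝ) where
  carrier := {F | F ∈ Dlc I ∧ Tendsto F (infRight I) (𝓝 0)}
  zero_mem' := ⟨zero_mem _, tendsto_const_nhds⟩
  add_mem' := fun hF hG => ⟨add_mem hF.1 hG.1, by
    have := hF.2.add hG.2; rwa [add_zero] at this⟩
  smul_mem' := fun c _ hF => ⟨(Dlc I).smul_mem c hF.1, by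
    have := hF.2.const_smul c; rwa [smul_zero] at this⟩

/-! ### Distributions on `I` -/

/-- The test functions: smooth functions on `ℝ` with compact support contained in `I`. -/
def TestFun (I : Set ℝ) : Submodule ℝ (ℝ → ℝ) where
  carrier := {φ | ContDiff ℝ (⊤ : ℕ∞) φ ∧ HasCompactSupport φ ∧ tsupport φ ⊆ I}
  zero_mem' := ⟨contDiff_const, HasCompactSupport.zero, by simp [tsupport]⟩
  add_mem' := fun hf hg => ⟨hf.1.add hg.1, hf.2.1.add hg.2.1,
    (tsupport_add _ _).trans (union_subset hf.2.2 hg.2.2)⟩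
  smul_mem' := fun c f hf => ⟨hf.1.const_smul c, hf.2.1.smul_left (f := fun _ => c),
    (tsupport_smul_subset_right (fun _ => c) f).trans hf.2.2⟩

/-- Convergence of sequences of test functions: all supports lie in one compact subset of `I`, and
the derivatives of each order converge uniformly. -/
def TestConverges {I : Set ℝ} (u : ℕ → TestFun I) (φ : TestFun I) : Prop :=
  (∃ K : Set ℝ, IsCompact K ∧ K ⊆ I ∧ ∀ n, tsupport (u n : ℝ → ℝ) ⊆ K) ∧
    ∀ m : ℕ, TendstoUniformly (fun n => iteratedDeriv m (u n : ℝ → ℝ))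
      (iteratedDeriv m (φ : ℝ → ℝ)) atTop

/-- The distributions on `I`: the continuous linear functionals on the test functions. -/
def Distr (I : Set ℝ) : Submodule ℝ (TestFun I →ₗ[ℝ] ℝ) where
  carrier := {T | ∀ (u : ℕ → TestFun I) (φ : TestFun I), TestConverges u φ →
    Tendsto (fun n => T (u n)) atTop (𝓝 (T φ))}
  zero_mem' := fun _ _ _ => tendsto_const_nhds
  add_mem' := fun hS hT u φ h => (hS u φ h).add (hT u φ h)
  smul_mem' := fun c _ hT u φ h => (hT u φ h).const_smul c

/-- `f` is the distributional derivative of `H`, that is, `⟨f, φ⟩ = -∫_a^b H φ'` for all test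
functions `φ`, where `supp φ' ⊆ [a, b] ⊆ I`. -/
def IsPrimitive {I : Set ℝ} (H : I → ℝ) (f : TestFun I →ₗ[ℝ] ℝ) : Prop :=
  ∀ (φ : TestFun I) (a b : ℝ) (hab : a < b), tsupport (deriv (φ : ℝ → ℝ)) ⊆ Icc a b →
    Icc a b ⊆ I →
    HasHKIntegral (fun t => zeroExt H t * deriv (φ : ℝ → ℝ) t) a b hab (-(f φ))

/-- `𝒜_D(I)`: the distributions on `I` that are the distributional derivative of a function of
`𝒟^{lr}(I)` whose right limit at `inf I` is `0`. -/
def AD (I : Set ℝ) : Submodule ℝ (TestFun I →ₗ[ℝ] ℝ) where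
  carrier := {f | f ∈ Distr I ∧ ∃ H ∈ Dlr I, Tendsto H (infRight I) (𝓝 0) ∧ IsPrimitive H f}
  zero_mem' := by
    refine ⟨zero_mem _, 0, zero_mem _, tendsto_const_nhds, fun φ a b hab _ _ => ?_⟩
    simpa [HasHKIntegral, zeroExt_zero] using hasIntegral_zero
  add_mem' := by
    rintro f g ⟨df, H, hH, lH, pH⟩ ⟨dg, K, hK, lK, pK⟩
    refine ⟨add_mem df dg, H + K, add_mem hH hK, by
      have := lH.add lK; rwa [add_zero] at this, fun φ a b hab h1 h2 => ?_⟩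
    have := (pH φ a b hab h1 h2).add (pK φ a b hab h1 h2)
    unfold HasHKIntegral
    convert this using 1
    · rw [zeroExt_add]; ext x; simp [add_mul]
    · simp; ring
  smul_mem' := by
    rintro c f ⟨df, H, hH, lH, pH⟩
    refine ⟨(Distr I).smul_mem c df, c • H, (Dlr I).smul_mem c hH, by
      have := lH.const_smul c; rwa [smul_zero] at this, fun φ a b hab h1 h2 => ?_⟩
    have := (pH φ a b hab h1 h2).smul c
    unfold HasHKIntegral
    convert this using 1
    · rw [zeroExt_smul]; ext x; simp [mul_assoc]
    · simp

/-- `ℱ(f)`: the primitive of `f` in `𝒟^{lc}_0(I)`. -/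
def prim {I : Set ℝ} (f : AD I) : Dlc0 I :=
  Classical.epsilon fun F : Dlc0 I => IsPrimitive (F : I → ℝ) (f : TestFun I →ₗ[ℝ] ℝ)

/-- The LD primitive integral `∫_a^b f = G(b) - G(a)`, where `G` is a primitive of `f` in
`𝒟^{lc}(I)`. -/
def ldIntegral {I : Set ℝ} (f : AD I) (a b : I) : ℝ :=
  let G : Dlc I := Classical.epsilon fun G : Dlc I => IsPrimitive (G : I → ℝ) (f : TestFun I →ₗ[ℝ] ℝ)
  (G : I → ℝ) b - (G : I → ℝ) a

/-! ### Order and norm -/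

/-- The absolute values of the integrals of `F` over the compact subintervals of `I`. -/
def alexSet {I : Set ℝ} (F : I → ℝ) : Set ℝ :=
  {s | ∃ (a b : ℝ) (hab : a < b), Icc a b ⊆ I ∧ s = |hkIntegral (zeroExt F) a b hab|}

/-- The Alexiewicz norm. -/
def alexNorm {I : Set ℝ} (F : I → ℝ) : ℝ := sSup (alexSet F)

/-- The partial order of `𝒜_D(I)`. -/
def ADle {I : Set ℝ} (f g : AD I) : Prop :=
  ∀ x : I, (prim f : I → ℝ) x ≤ (prim g : I → ℝ) x

/-- The norm of `𝒜_D(I)`. -/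
def ADnorm {I : Set ℝ} (f : AD I) : ℝ := alexNorm (prim f : I → ℝ)

/-- The real vector space `E` with the relation `le` and the function `N` is an ordered normed
space: an ordered vector space with a norm, in which the order cone is closed. -/
structure IsOrderedNormedSpace {E : Type*} [AddCommGroup E] [Module ℝ E]
    (le : E → E → Prop) (N : E → ℝ) : Prop where
  le_refl : ∀ x, le x x
  le_antisymm : ∀ x y, le x y → le y x → x = y
  le_trans : ∀ x y z, le x y → le y z → le x z
  add_le_add : ∀ x y z, le x y → le (x + z) (y + z)
  smul_le_smul : ∀ (k : ℝ) (x y : E), 0 ≤ k → le x y → le (k • x) (k • y)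
  norm_nonneg : ∀ x, 0 ≤ N x
  norm_eq_zero : ∀ x, N x = 0 ↔ x = 0
  norm_smul : ∀ (k : ℝ) (x : E), N (k • x) = |k| * N x
  norm_add_le : ∀ x y, N (x + y) ≤ N x + N y
  /-- a point of the closure of the order cone belongs to the cone -/
  cone_closed : ∀ x, (∀ ε : ℝ, 0 < ε → ∃ y, le 0 y ∧ N (y - x) < ε) → le 0 x

end LDPrimitive

end

open LDPrimitive

namespace LDPrimitive

/-! Everything rests on one fact: a function that is globally HK integrable on `I` has a bounded
indefinite integral `P` (`HKIntegrableOn.exists_isIndefinite`), so the Alexiewicz norm is finite.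
Integrals see enough of a left continuous function to control its sign: a negative value persists on
a short interval to the left, where the integral is then negative (`nonneg_of_hkIntegral_nonneg`).
Applied to `F` and `-F` this makes the norm definite; applied to limits in norm it makes the cone
closed.

For distributions, four facts make `prim` a bijection. Uniqueness of the primitive is a du
Bois-Reymond argument: testing with the difference of two smooth steps compares averages of `F` just
to the left of two points (`IsPrimitive.eq_of_not_isMin`), and the limit at `inf I` fixes the
constant. Existence in `Dlc0 I` follows by passing to left limits: this changes a left regulated
function at countably many points only, which affects neither global integrability nor the
distributional derivative (`exists_leftContinuous`). Surjectivity holds because `φ ↦ ∫ P φ''` is a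
continuous functional, and integration by parts, derived from the Saks–Henstock lemma, identifies it
with `φ ↦ -∫ F φ'` (`HKIntegrableOn.exists_isPrimitive`). Injectivity is `IsPrimitive.unique`. Order
and norm are then transported along this bijection.

A primitive with limit `l ≠ 0` at `inf I` must be shifted by `l`. For bounded `I` the constant is
integrable; for `I` unbounded below, `l ≠ 0` would make the integrals near `-∞` unbounded, so `l =
0`. -/

/-! ### One-dimensional boxes -/

lemma box_eta (J : Box (Fin 1)) : box (J.lower 0) (J.upper 0) (J.lower_lt_upper 0) = J := by
  obtain ⟨l, u, h⟩ := J
  simp only [box, Box.mk.injEq]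
  exact ⟨funext fun i => by rw [Subsingleton.elim i 0], funext fun i => by
    rw [Subsingleton.elim i 0]⟩

lemma box_le_box {a b c d : ℝ} {hab : a < b} {hcd : c < d} (h1 : c ≤ a) (h2 : b ≤ d) :
    box a b hab ≤ box c d hcd :=
  Box.le_iff_bounds.2 ⟨fun _ => h1, fun _ => h2⟩

lemma mem_Icc_box {a b : ℝ} {hab : a < b} {x : Fin 1 → ℝ} :
    x ∈ Box.Icc (box a b hab) ↔ x 0 ∈ Icc a b := by
  rw [Box.Icc_def, Set.mem_Icc, Set.mem_Icc, Pi.le_def, Pi.le_def, Fin.forall_fin_one,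
    Fin.forall_fin_one]
  rfl

lemma mem_Icc_iff {J : Box (Fin 1)} {x : Fin 1 → ℝ} :
    x ∈ Box.Icc J ↔ x 0 ∈ Icc (J.lower 0) (J.upper 0) := by
  rw [Box.Icc_def, Set.mem_Icc, Set.mem_Icc, Pi.le_def, Pi.le_def, Fin.forall_fin_one,
    Fin.forall_fin_one]

lemma integralSum_volume {I : Box (Fin 1)} (f : (Fin 1 → ℝ) → ℝ) (π : TaggedPrepartition I) :
    integralSum f BoxAdditiveMap.volume π =
      ∑ J ∈ π.boxes, (J.upper 0 - J.lower 0) * f (π.tag J) := by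
  simp [integralSum, BoxAdditiveMap.volume_apply]

/-- The box additive function of the increments of `Q`. -/
def increment (Q : ℝ → ℝ) : Fin 1 →ᵇᵃ ℝ :=
  BoxAdditiveMap.ofMapSplitAdd (fun J => Q (J.upper 0) - Q (J.lower 0)) ⊤ (by
    intro J _ i x hx
    obtain rfl : i = 0 := Subsingleton.elim _ _
    rw [Box.splitLower_def hx, Box.splitUpper_def hx]
    simp only [Option.elim', Function.update_self]
    ring)

/-- Telescoping: box additivity replaces an ordering of the boxes. The case `Q = id` gives the total
length. -/
lemma sum_increment (Q : ℝ → ℝ) {I : Box (Fin 1)} {π : TaggedPrepartition I}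
    (hπ : π.IsPartition) :
    ∑ J ∈ π.boxes, (Q (J.upper 0) - Q (J.lower 0)) = Q (I.upper 0) - Q (I.lower 0) :=
  (increment Q).sum_partition_boxes le_top hπ

/-- The Henstock parameters impose no distortion bound, so both distortion clauses are vacuous and
`c` is arbitrary. -/
lemma memBaseSet_henstock {I : Box (Fin 1)} {π : TaggedPrepartition I}
    {r : (Fin 1 → ℝ) → Ioi (0 : ℝ)} (hH : π.IsHenstock) (hs : π.IsSubordinate r) (c : NNReal) :
    IntegrationParams.Henstock.MemBaseSet I c r π :=
  ⟨hs, fun _ => hH, fun h => by simp [IntegrationParams.Henstock] at h,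
    fun h => by simp [IntegrationParams.Henstock] at h⟩

/-- A gauge form of `HasHKIntegral` in which the distortion parameter does not occur. -/
lemma hasHKIntegral_iff {f : ℝ → ℝ} {a b : ℝ} {hab : a < b} {y : ℝ} :
    HasHKIntegral f a b hab y ↔ ∀ ε : ℝ, 0 < ε → ∃ r : (Fin 1 → ℝ) → Ioi (0 : ℝ),
      ∀ π : TaggedPrepartition (box a b hab), π.IsPartition → π.IsHenstock → π.IsSubordinate r →
        |integralSum (fun x : Fin 1 → ℝ => f (x 0)) BoxAdditiveMap.volume π - y| ≤ ε := by
  rw [HasHKIntegral, hasIntegral_iff]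
  refine forall₂_congr fun ε hε => ⟨?_, ?_⟩
  · rintro ⟨r, _, h⟩
    exact ⟨r 0, fun π hp hH hs => h 0 π (memBaseSet_henstock hH hs 0) hp⟩
  · rintro ⟨r, h⟩
    exact ⟨fun _ => r, fun _ => IntegrationParams.rCond_of_bRiemann_eq_false _ rfl,
      fun c π hm hp => h π hp (hm.2 rfl) hm.1⟩

/-- Gauge fine Henstock partitions of a box exist. -/
lemma exists_partition (I : Box (Fin 1)) (r : (Fin 1 → ℝ) → Ioi (0 : ℝ)) :
    ∃ π : TaggedPrepartition I, π.IsPartition ∧ π.IsHenstock ∧ π.IsSubordinate r := by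
  obtain ⟨π, h, hp⟩ := IntegrationParams.Henstock.exists_memBaseSet_isPartition I le_rfl r
  exact ⟨π, hp, h.2 rfl, h.1⟩

/-! ### Basic properties of the Henstock–Kurzweil integral -/

section Basic

variable {f g : ℝ → ℝ} {a b : ℝ} {hab : a < b} {y z : ℝ}

lemma HasHKIntegral.hkIntegral_eq (h : HasHKIntegral f a b hab y) : hkIntegral f a b hab = y :=
  HasIntegral.integral_eq h

lemma HasHKIntegral.unique (h : HasHKIntegral f a b hab y) (h' : HasHKIntegral f a b hab z) :
    y = z :=
  HasIntegral.unique h h'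

lemma HasHKIntegral.add (h : HasHKIntegral f a b hab y) (h' : HasHKIntegral g a b hab z) :
    HasHKIntegral (fun x => f x + g x) a b hab (y + z) :=
  HasIntegral.add h h'

lemma HasHKIntegral.sub (h : HasHKIntegral f a b hab y) (h' : HasHKIntegral g a b hab z) :
    HasHKIntegral (fun x => f x - g x) a b hab (y - z) :=
  HasIntegral.sub h h'

lemma HasHKIntegral.const_mul (h : HasHKIntegral f a b hab y) (c : ℝ) :
    HasHKIntegral (fun x => c * f x) a b hab (c * y) :=
  HasIntegral.smul h c

lemma HasHKIntegral.congr (h : HasHKIntegral f a b hab y) (hfg : ∀ x ∈ Icc a b, f x = g x) :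
    HasHKIntegral g a b hab y := by
  rw [hasHKIntegral_iff] at h ⊢
  refine fun ε hε => (h ε hε).imp fun r hr π hp hH hs => ?_
  rw [← integralSum_congr (f₁ := fun x : Fin 1 → ℝ => f (x 0)) _ fun _ _ => rfl]
  · exact hr π hp hH hs
  · exact fun x hx => hfg _ (mem_Icc_box.1 hx)

lemma HasHKIntegral.mono (h : HasHKIntegral f a b hab y) (h' : HasHKIntegral g a b hab z)
    (hfg : ∀ x ∈ Icc a b, f x ≤ g x) : y ≤ z := by
  refine le_of_tendsto_of_tendsto' h h' fun π => ?_
  rw [integralSum_volume, integralSum_volume]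
  refine Finset.sum_le_sum fun J hJ => ?_
  gcongr
  · exact sub_nonneg.2 (J.lower_le_upper 0)
  · exact hfg _ (mem_Icc_box.1 (π.tag_mem_Icc J))

lemma hasHKIntegral_const (c : ℝ) : HasHKIntegral (fun _ => c) a b hab ((b - a) * c) := by
  have := hasIntegral_const (I := box a b hab) (l := IntegrationParams.Henstock)
    (vol := BoxAdditiveMap.volume) c
  rw [BoxAdditiveMap.volume_apply, Fin.prod_univ_one] at this
  exact this

lemma HasHKIntegral.eq_add_adjacent {c w : ℝ} {hbc : b < c} {hac : a < c}
    (h : HasHKIntegral f a c hac w) (h1 : HasHKIntegral f a b hab y)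
    (h2 : HasHKIntegral f b c hbc z) : w = y + z := by
  have hi : BoxIntegral.Integrable (box a c hac) IntegrationParams.Henstock
    (fun x : Fin 1 → ℝ => f (x 0)) BoxAdditiveMap.volume := ⟨w, h⟩
  have hx : b ∈ Ioo ((box a c hac).lower 0) ((box a c hac).upper 0) := ⟨hab, hbc⟩
  have := hi.toBoxAdditive.map_split_add le_rfl 0 b
  rw [Box.splitLower_def hx, Box.splitUpper_def hx] at this
  simp only [Option.elim', Integrable.toBoxAdditive_apply] at this
  have e : integral (box a c hac) IntegrationParams.Henstock
    (fun x : Fin 1 → ℝ => f (x 0)) BoxAdditiveMap.volume = w := HasIntegral.integral_eq h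
  rw [e] at this
  rw [← this, ← HasIntegral.integral_eq h1, ← HasIntegral.integral_eq h2]
  congr 2
  · rw [← box_eta ⟨_, _, _⟩]; simp [box]
  · rw [← box_eta ⟨_, _, _⟩]; simp [box]

lemma coe_box : (box a b hab : Set (Fin 1 → ℝ)) =
    (MeasurableEquiv.funUnique (Fin 1) ℝ) ⁻¹' Ioc a b := by
  ext x
  simp only [Box.mem_coe, Box.mem_def, Fin.forall_fin_one, mem_preimage]
  rfl

/-- The link to the Lebesgue integral; the identification of `Fin 1 → ℝ` with `ℝ` preserves measure
and carries the half-open box to `Ioc a b`. -/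
lemma hasHKIntegral_of_integrableOn (hf : MeasureTheory.IntegrableOn f (Ioc a b)) :
    HasHKIntegral f a b hab (∫ x in a..b, f x) := by
  have hp := MeasureTheory.volume_preserving_funUnique (Fin 1) ℝ
  have h1 : MeasureTheory.IntegrableOn (fun x : Fin 1 → ℝ => f (x 0)) (box a b hab) := by
    rw [coe_box]
    exact (hp.integrableOn_comp_preimage (MeasurableEquiv.measurableEmbedding _)).2 hf
  have h2 := h1.hasBoxIntegral IntegrationParams.Henstock rfl
  have h3 : ∫ x in (box a b hab : Set (Fin 1 → ℝ)), f (x 0) = ∫ x in a..b, f x := by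
    rw [intervalIntegral.integral_of_le hab.le, coe_box]
    exact hp.setIntegral_preimage_emb (MeasurableEquiv.measurableEmbedding _) f _
  rw [h3] at h2
  exact h2

lemma hasHKIntegral_of_continuousOn (hf : ContinuousOn f (Icc a b)) :
    HasHKIntegral f a b hab (∫ x in a..b, f x) :=
  hasHKIntegral_of_integrableOn (hf.integrableOn_Icc.mono_set Ioc_subset_Icc_self)

lemma hasHKIntegral_zero_of_countable (hf : {x | f x ≠ 0}.Countable) :
    HasHKIntegral f a b hab 0 := by
  have h0 : f =ᵐ[MeasureTheory.volume] 0 := hf.ae_notMem _ |>.mono fun x hx => by simpa using hx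
  have h1 : MeasureTheory.IntegrableOn f (Ioc a b) :=
    (MeasureTheory.integrable_zero _ _ _).congr h0.symm |>.integrableOn
  have := hasHKIntegral_of_integrableOn (hab := hab) h1
  rwa [intervalIntegral.integral_congr_ae (g := fun _ => 0) (h0.mono fun x hx _ => hx),
    intervalIntegral.integral_zero] at this

end Basic

/-! ### Indefinite integrals -/

/-- `P` is an indefinite Henstock–Kurzweil integral of `f` on `S`. -/
def IsIndefinite (f : ℝ → ℝ) (S : Set ℝ) (P : ℝ → ℝ) : Prop :=
  ∀ (a b : ℝ) (hab : a < b), Icc a b ⊆ S → HasHKIntegral f a b hab (P b - P a)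

lemma IsIndefinite.mono {f P : ℝ → ℝ} {S T : Set ℝ} (h : IsIndefinite f S P) (hT : T ⊆ S) :
    IsIndefinite f T P := fun a b hab hs => h a b hab (hs.trans hT)

lemma exists_isIndefinite {f : ℝ → ℝ} {S : Set ℝ} (hS : S.OrdConnected)
    (hf : ∀ (a b : ℝ) (hab : a < b), Icc a b ⊆ S → ∃ y, HasHKIntegral f a b hab y) :
    ∃ P, IsIndefinite f S P := by
  rcases S.eq_empty_or_nonempty with rfl | ⟨x₀, hx₀⟩
  · exact ⟨0, fun a b hab h => (h (left_mem_Icc.2 hab.le)).elim⟩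
  -- The signed integral from the base point `x₀`; the cases are needed because `hkIntegral` takes a
  -- proof that its endpoints are in strict order.
  refine ⟨fun x => if h : x₀ < x then hkIntegral f x₀ x h else
    if h : x < x₀ then - hkIntegral f x x₀ h else 0, fun a b hab hs => ?_⟩
  have ha := hs (left_mem_Icc.2 hab.le)
  have hb := hs (right_mem_Icc.2 hab.le)
  have key : ∀ (u v : ℝ) (huv : u < v), u ∈ S → v ∈ S →
      HasHKIntegral f u v huv (hkIntegral f u v huv) := fun u v huv hu hv => by
    obtain ⟨y, hy⟩ := hf u v huv (hS.out hu hv)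
    rwa [hy.hkIntegral_eq]
  have hm := key a b hab ha hb
  convert hm using 1
  rcases lt_trichotomy x₀ a with h | rfl | h
  · have h' := h.trans hab
    simp only [h, h', dif_pos]
    rw [(key x₀ b h' hx₀ hb).eq_add_adjacent (key x₀ a h hx₀ ha) hm]; ring
  · simp [hab]
  · rcases lt_trichotomy x₀ b with h' | rfl | h'
    · simp only [h, h', h.not_gt, dif_pos, dif_neg, not_false_iff]
      rw [hm.eq_add_adjacent (key a x₀ h ha hx₀) (key x₀ b h' hx₀ hb)]; ring
    · simp [h, h.not_gt]
    · simp only [h, h', h.not_gt, h'.not_gt, dif_pos, dif_neg, not_false_iff]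
      rw [(key a x₀ h ha hx₀).eq_add_adjacent hm (key b x₀ h' hb hx₀)]; ring

section Indefinite

variable {f P : ℝ → ℝ} {a b : ℝ}

lemma IsIndefinite.integral_box (h : IsIndefinite f (Icc a b) P) {hab : a < b} {J : Box (Fin 1)}
    (hJ : J ≤ box a b hab) :
    integral J IntegrationParams.Henstock (fun x : Fin 1 → ℝ => f (x 0)) BoxAdditiveMap.volume =
      P (J.upper 0) - P (J.lower 0) := by
  obtain ⟨h1, h2⟩ := Box.le_iff_bounds.1 hJ
  have := (h (J.lower 0) (J.upper 0) (J.lower_lt_upper 0)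
    (Icc_subset_Icc (h1 0) (h2 0))).hkIntegral_eq
  rwa [hkIntegral, box_eta] at this

/-- The **Saks–Henstock lemma**, with absolute values inside the sum. -/
lemma IsIndefinite.saks_henstock (h : IsIndefinite f (Icc a b) P) (hab : a < b) {ε : ℝ}
    (hε : 0 < ε) : ∃ r : (Fin 1 → ℝ) → Ioi (0 : ℝ), ∀ π : TaggedPrepartition (box a b hab),
      π.IsHenstock → π.IsSubordinate r →
      ∑ J ∈ π.boxes, |(J.upper 0 - J.lower 0) * f (π.tag J 0) -
        (P (J.upper 0) - P (J.lower 0))| ≤ ε := by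
  classical
  have hi : BoxIntegral.Integrable (box a b hab) IntegrationParams.Henstock
    (fun x : Fin 1 → ℝ => f (x 0)) BoxAdditiveMap.volume := ⟨_, h a b hab subset_rfl⟩
  refine ⟨hi.convergenceR (ε / 2) 0, fun π hH hs => ?_⟩
  set d : Box (Fin 1) → ℝ := fun J => (J.upper 0 - J.lower 0) * f (π.tag J 0) -
        (P (J.upper 0) - P (J.lower 0)) with hd
  -- The usual Saks–Henstock lemma bounds the sum over any subfamily of boxes. The subfamilies `0 ≤
  -- d J` and `d J < 0` cost `ε / 2` each and bring the absolute value inside.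
  have key : ∀ (p : Box (Fin 1) → Prop) [DecidablePred p],
      |∑ J ∈ π.boxes with p J, d J| ≤ ε / 2 := fun p inst => by
    obtain rfl : inst = fun J => Classical.propDecidable (p J) := Subsingleton.elim _ _
    have := hi.dist_integralSum_sum_integral_le_of_memBaseSet (half_pos hε)
      ((memBaseSet_henstock hH hs 0).filter p)
    rw [integralSum_volume, Real.dist_eq, ← Finset.sum_sub_distrib] at this
    convert this using 2
    refine Finset.sum_congr rfl fun J hJ => ?_
    rw [h.integral_box (hab := hab)]
    · rfl
    · exact π.le_of_mem' J (Finset.mem_filter.1 hJ).1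
  have k1 := key fun J => 0 ≤ d J
  have k2 := key fun J => ¬ 0 ≤ d J
  rw [← Finset.sum_filter_add_sum_filter_not π.boxes (fun J => 0 ≤ d J)]
  have e1 : ∑ J ∈ π.boxes with 0 ≤ d J, |d J| = ∑ J ∈ π.boxes with 0 ≤ d J, d J :=
    Finset.sum_congr rfl fun J hJ => abs_of_nonneg (Finset.mem_filter.1 hJ).2
  have e2 : ∑ J ∈ π.boxes with ¬ 0 ≤ d J, |d J| = - ∑ J ∈ π.boxes with ¬ 0 ≤ d J, d J := by
    rw [← Finset.sum_neg_distrib]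
    exact Finset.sum_congr rfl fun J hJ => abs_of_neg (not_le.1 (Finset.mem_filter.1 hJ).2)
  rw [e1, e2]
  linarith [(abs_le.1 k1).2, (abs_le.1 k2).1]

/-- Saks–Henstock for a single box tagged at `t` puts `P v - P u` close to `(v - u) * f t`, which is
small for short boxes. -/
lemma IsIndefinite.continuousOn (h : IsIndefinite f (Icc a b) P) : ContinuousOn P (Icc a b) := by
  rcases lt_or_ge a b with hab | hab
  swap
  · exact (subsingleton_Icc_of_ge hab).continuousOn _
  intro t ht
  rw [ContinuousWithinAt, Metric.tendsto_nhdsWithin_nhds]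
  intro ε hε
  obtain ⟨r, hr⟩ := h.saks_henstock hab (half_pos (half_pos hε))
  have hpos : 0 < ε / 4 / (|f t| + 1) := by positivity
  -- The first entry makes the box fine for the gauge, the second gives `|(v - u) * f t| ≤ ε / 4`.
  set δ : ℝ := min (r fun _ => t) (ε / 4 / (|f t| + 1)) with hδ
  have small : ∀ u v : ℝ, u < v → u ∈ Icc a b → v ∈ Icc a b → t ∈ Icc u v → v - u < δ →
      |P v - P u| < ε := by
    intro u v huv hu hv ht' hlt
    have hle : box u v huv ≤ box a b hab := box_le_box hu.1 hv.2
    have := hr (TaggedPrepartition.single _ _ hle (fun _ => t) (mem_Icc_box.2 ht))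
      (TaggedPrepartition.isHenstock_single_iff _ _ |>.2 (mem_Icc_box.2 ht'))
      (TaggedPrepartition.isSubordinate_single _ _ |>.2 fun x hx => by
        have hx := mem_Icc_box.1 hx
        rw [Metric.mem_closedBall, dist_pi_le_iff (r _).2.le, Fin.forall_fin_one, Real.dist_eq,
          abs_le]
        have := hlt.le.trans (min_le_left _ _)
        constructor <;> linarith [hx.1, hx.2, ht'.1, ht'.2])
    simp only [TaggedPrepartition.single, Prepartition.single, Finset.sum_singleton] at this
    simp only [box] at this
    have h2 : |(v - u) * f t| ≤ ε / 4 := by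
      rw [abs_mul, abs_of_pos (sub_pos.2 huv)]
      calc (v - u) * |f t| ≤ (ε / 4 / (|f t| + 1)) * (|f t| + 1) := by
            gcongr
            · exact hlt.le.trans (min_le_right _ _)
            · linarith
        _ = ε / 4 := by field_simp
    rw [abs_le] at *
    rw [abs_lt]
    constructor <;> linarith [this.1, this.2, h2.1, h2.2]
  refine ⟨δ, lt_min (r _).2 hpos, fun x hx hxt => ?_⟩
  rw [Real.dist_eq] at *
  rcases lt_trichotomy x t with hlt | rfl | hlt
  · rw [abs_sub_comm]
    exact small x t hlt hx ht ⟨hlt.le, le_rfl⟩ (by rw [abs_of_neg (by linarith)] at hxt; linarith)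
  · simpa using hε
  · exact small t x hlt ht hx ⟨le_rfl, hlt.le⟩ (by rw [abs_of_pos (by linarith)] at hxt; linarith)

/-- **Integration by parts** for the Henstock–Kurzweil integral. -/
lemma IsIndefinite.hasHKIntegral_mul (h : IsIndefinite f (Icc a b) P) (hab : a < b)
    {ψ : ℝ → ℝ} (hψ : ContDiff ℝ 1 ψ) :
    HasHKIntegral (fun x => f x * ψ x) a b hab
      (P b * ψ b - P a * ψ a - ∫ x in a..b, P x * deriv ψ x) := by
  have hc := h.continuousOn
  have hd : ContinuousOn (fun x => P x * deriv ψ x) (Icc a b) :=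
    hc.mul (hψ.continuous_deriv le_rfl).continuousOn
  -- The Riemann sums of `f ψ + P ψ'` nearly telescope to the increment of `P ψ`, and `P ψ'` is
  -- continuous, so its integral can be subtracted.
  suffices H : HasHKIntegral (fun x => f x * ψ x + P x * deriv ψ x) a b hab
      (P b * ψ b - P a * ψ a) by
    simpa using H.sub (hasHKIntegral_of_continuousOn hd)
  rw [hasHKIntegral_iff]
  intro ε hε
  obtain ⟨M, hM⟩ := isCompact_Icc.exists_bound_of_continuousOn (s := Icc a b)
    hψ.continuous.continuousOn
  have hM0 : 0 ≤ M := (norm_nonneg _).trans (hM a ⟨le_rfl, hab.le⟩)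
  -- `M` may vanish, hence `M + 1`. Saks–Henstock contributes `ε / 2`, and the local product rule
  -- below contributes `η * (b - a) = ε / 2`.
  obtain ⟨r, hr⟩ := h.saks_henstock hab (ε := ε / 2 / (M + 1)) (by positivity)
  set η : ℝ := ε / 2 / (b - a) with hη
  have hη0 : 0 < η := div_pos (half_pos hε) (sub_pos.2 hab)
  -- A straddle form of the product rule, which needs `P` only continuous and `ψ` differentiable at
  -- `t`.
  have hloc : ∀ t ∈ Icc a b, ∃ δ : Ioi (0 : ℝ), ∀ u v, u ∈ Icc a b → v ∈ Icc a b → t ∈ Icc u v →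
      |u - t| ≤ δ.1 → |v - t| ≤ δ.1 → |ψ t * (P v - P u) + (v - u) * (P t * deriv ψ t) -
        (P v * ψ v - P u * ψ u)| ≤ η * (v - u) := by
    intro t ht
    -- The bound `1` yields `|P x| ≤ |P t| + 1` near `t`; the quotient makes the total error at most
    -- `η * |x - t|`.
    set κ : ℝ := min 1 (η / (1 + |P t| + |deriv ψ t|)) with hκ
    have hκ0 : 0 < κ := by positivity
    have hκ1 : κ * (1 + |P t| + |deriv ψ t|) ≤ η := by
      calc _ ≤ η / (1 + |P t| + |deriv ψ t|) * (1 + |P t| + |deriv ψ t|) := by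
            gcongr; exact min_le_right _ _
        _ = η := by field_simp
    have d1 := (hψ.differentiable one_ne_zero t).hasDerivAt
    rw [hasDerivAt_iff_isLittleO] at d1
    obtain ⟨δ₁, hδ₁, h1⟩ := Metric.eventually_nhds_iff.1 (d1.def hκ0)
    obtain ⟨δ₂, hδ₂, h2⟩ := Metric.continuousWithinAt_iff.1 (hc t ht) κ hκ0
    have step : ∀ x ∈ Icc a b, |x - t| < δ₁ → |x - t| < δ₂ →
        |P t * deriv ψ t * (x - t) - P x * (ψ x - ψ t)| ≤ η * |x - t| := by
      intro x hx hx1 hx2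
      have e1 := h1 (y := x) (by rwa [Real.dist_eq])
      have e2 := (h2 hx (by rwa [Real.dist_eq])).le
      rw [Real.norm_eq_abs, Real.norm_eq_abs, smul_eq_mul] at e1
      rw [Real.dist_eq] at e2
      have e3 : |P x| ≤ |P t| + 1 := by
        have := abs_sub_abs_le_abs_sub (P x) (P t)
        linarith [min_le_left 1 (η / (1 + |P t| + |deriv ψ t|))]
      have e4 : P t * deriv ψ t * (x - t) - P x * (ψ x - ψ t) =
        -((P x - P t) * (deriv ψ t * (x - t))) - P x * (ψ x - ψ t - (x - t) * deriv ψ t) := by ring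
      rw [e4]
      calc _ ≤ |(P x - P t) * (deriv ψ t * (x - t))| +
            |P x * (ψ x - ψ t - (x - t) * deriv ψ t)| := by
              refine (abs_sub _ _).trans ?_
              rw [abs_neg]
        _ ≤ κ * (|deriv ψ t| * |x - t|) + (|P t| + 1) * (κ * |x - t|) := by
              rw [abs_mul, abs_mul, abs_mul (P x)]
              gcongr
        _ = κ * (1 + |P t| + |deriv ψ t|) * |x - t| := by ring
        _ ≤ η * |x - t| := by gcongr
    -- Halved because subordination gives non-strict bounds, while `step` requires strict ones.
    refine ⟨⟨min δ₁ δ₂ / 2, by rw [mem_Ioi]; positivity⟩, fun u v hu hv htuv hut hvt => ?_⟩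
    have hlt : min δ₁ δ₂ / 2 < min δ₁ δ₂ := half_lt_self (by positivity)
    have su := step u hu ((hut.trans_lt hlt).trans_le (min_le_left _ _))
      ((hut.trans_lt hlt).trans_le (min_le_right _ _))
    have sv := step v hv ((hvt.trans_lt hlt).trans_le (min_le_left _ _))
      ((hvt.trans_lt hlt).trans_le (min_le_right _ _))
    rw [abs_of_nonpos (sub_nonpos.2 htuv.1)] at su
    rw [abs_of_nonneg (sub_nonneg.2 htuv.2)] at sv
    have e : ψ t * (P v - P u) + (v - u) * (P t * deriv ψ t) - (P v * ψ v - P u * ψ u) =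
      (P t * deriv ψ t * (v - t) - P v * (ψ v - ψ t)) -
        (P t * deriv ψ t * (u - t) - P u * (ψ u - ψ t)) := by ring
    rw [e]
    refine (abs_sub _ _).trans ?_
    linarith
  have : Nonempty (Ioi (0 : ℝ)) := ⟨⟨1, mem_Ioi.2 one_pos⟩⟩
  choose! δ hloc using hloc
  refine ⟨fun x => min (r x) (δ (x 0)), fun π hp hH hs => ?_⟩
  have hs1 : π.IsSubordinate r := hs.mono fun x _ => min_le_left _ _
  have hs2 : π.IsSubordinate fun x => δ (x 0) := hs.mono fun x _ => min_le_right _ _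
  have hsaks := hr π hH hs1
  rw [integralSum_volume]
  have hsum := sum_increment (fun x => P x * ψ x) hp
  have hlen := sum_increment (fun x => x) hp
  simp only [box] at hsum hlen
  rw [← hsum, ← Finset.sum_sub_distrib]
  calc _ ≤ ∑ J ∈ π.boxes, (M * |(J.upper 0 - J.lower 0) * f (π.tag J 0) -
        (P (J.upper 0) - P (J.lower 0))| + η * (J.upper 0 - J.lower 0)) := by
        refine (Finset.abs_sum_le_sum_abs _ _).trans (Finset.sum_le_sum fun J hJ => ?_)
        have ht := mem_Icc_box.1 (π.tag_mem_Icc J)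
        have hJle := Box.le_iff_Icc.1 (π.le_of_mem' J hJ)
        have hu := mem_Icc_box.1 (hJle J.lower_mem_Icc)
        have hv := mem_Icc_box.1 (hJle J.upper_mem_Icc)
        have hb : ∀ x ∈ Box.Icc J, |x 0 - π.tag J 0| ≤ (δ (π.tag J 0)).1 := fun x hx =>
          (dist_le_pi_dist x (π.tag J) 0).trans (hs2 J hJ hx)
        have k := hloc _ ht _ _ hu hv (mem_Icc_iff.1 (hH J hJ)) (hb _ J.lower_mem_Icc)
          (hb _ J.upper_mem_Icc)
        have e : (J.upper 0 - J.lower 0) * (f (π.tag J 0) * ψ (π.tag J 0) +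
            P (π.tag J 0) * deriv ψ (π.tag J 0)) -
            (P (J.upper 0) * ψ (J.upper 0) - P (J.lower 0) * ψ (J.lower 0)) =
          ψ (π.tag J 0) * ((J.upper 0 - J.lower 0) * f (π.tag J 0) -
            (P (J.upper 0) - P (J.lower 0))) +
          (ψ (π.tag J 0) * (P (J.upper 0) - P (J.lower 0)) + (J.upper 0 - J.lower 0) *
            (P (π.tag J 0) * deriv ψ (π.tag J 0)) -
            (P (J.upper 0) * ψ (J.upper 0) - P (J.lower 0) * ψ (J.lower 0))) := by ring
        rw [e]
        refine (abs_add_le _ _).trans (add_le_add ?_ k)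
        rw [abs_mul]
        gcongr
        exact hM _ ht
    _ ≤ (M + 1) * (ε / 2 / (M + 1)) + η * (b - a) := by
        rw [Finset.sum_add_distrib, ← Finset.mul_sum, ← Finset.mul_sum, hlen]
        gcongr
        linarith
    _ = ε := by rw [hη]; field_simp [(sub_pos.2 hab).ne']; ring

end Indefinite

end LDPrimitive

namespace LDPrimitive

/-! ### Integrals over unbounded intervals -/

/-- The points between `inf I` and `sup I`. -/
def hull (I : Set ℝ) : Set ℝ := {x | (BddBelow I → sInf I ≤ x) ∧ (BddAbove I → x ≤ sSup I)}

lemma subset_hull (I : Set ℝ) : I ⊆ hull I :=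
  fun _ hx => ⟨fun h => csInf_le h hx, fun h => le_csSup h hx⟩

lemma ordConnected_hull (I : Set ℝ) : (hull I).OrdConnected :=
  ⟨fun _ hx _ hy _ hz => ⟨fun h => (hx.1 h).trans hz.1, fun h => hz.2.trans (hy.2 h)⟩⟩

/-- Enlarges `[a, b]` to a box on which the global gauge condition applies: finite ends move to
`sInf I` or `sSup I`, infinite ends beyond `R`. -/
lemma exists_spans {I : Set ℝ} (R : ℝ) {a b : ℝ} (hab : a < b) (ha : a ∈ hull I)
    (hb : b ∈ hull I) : ∃ (l u : ℝ) (h : l < u), Spans I R (box l u h) ∧ l ≤ a ∧ b ≤ u ∧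
      l ∈ hull I ∧ u ∈ hull I := by
  have hl : ∃ l, l ≤ a ∧ (BddBelow I → l = sInf I) ∧ (¬ BddBelow I → l ≤ -R) := by
    by_cases h : BddBelow I
    · exact ⟨sInf I, ha.1 h, fun _ => rfl, fun h' => (h' h).elim⟩
    · exact ⟨min a (-R), min_le_left _ _, fun h' => (h h').elim, fun _ => min_le_right _ _⟩
  have hu : ∃ u, b ≤ u ∧ (BddAbove I → u = sSup I) ∧ (¬ BddAbove I → R ≤ u) := by
    by_cases h : BddAbove I
    · exact ⟨sSup I, hb.2 h, fun _ => rfl, fun h' => (h' h).elim⟩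
    · exact ⟨max b R, le_max_left _ _, fun h' => (h h').elim, fun _ => le_max_right _ _⟩
  obtain ⟨l, l1, l2, l3⟩ := hl
  obtain ⟨u, u1, u2, u3⟩ := hu
  exact ⟨l, u, by linarith, ⟨l2, l3, u2, u3⟩, l1, u1, ⟨fun h => (l2 h).ge,
    fun h => by linarith [hb.2 h]⟩, ⟨fun h => by linarith [ha.1 h], fun h => (u2 h).le⟩⟩

/-- A function that is integrable over `I` is integrable over every compact interval between
`inf I` and `sup I`. -/
lemma HKIntegrableOn.exists_hasHKIntegral {I : Set ℝ} {F : I → ℝ} (hF : HKIntegrableOn F)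
    {a b : ℝ} (hab : a < b) (h : Icc a b ⊆ hull I) :
    ∃ y, HasHKIntegral (zeroExt F) a b hab y := by
  obtain ⟨y, hy⟩ := hF
  refine (integrable_iff_cauchy_basis (I := box a b hab) (l := IntegrationParams.Henstock)
    (f := fun x : Fin 1 → ℝ => zeroExt F (x 0)) (vol := BoxAdditiveMap.volume)).2 fun ε hε => ?_
  obtain ⟨r, R, hr⟩ := hy (ε / 2) (half_pos hε)
  obtain ⟨l, u, hlu, hsp, hla, hbu, -⟩ := exists_spans R hab (h (left_mem_Icc.2 hab.le))
    (h (right_mem_Icc.2 hab.le))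
  have hle : box a b hab ≤ box l u hlu := box_le_box hla hbu
  -- For the Cauchy criterion, all fine partitions of `[a, b]` are completed by the same fine
  -- partition of the complement, whose sum cancels on comparison.
  set C := (Prepartition.single (box l u hlu) (box a b hab) hle).compl with hC
  have key : ∀ π : TaggedPrepartition (box a b hab), π.IsPartition → π.IsHenstock →
      π.IsSubordinate r → |integralSum (fun x : Fin 1 → ℝ => zeroExt F (x 0))
        BoxAdditiveMap.volume π + integralSum (fun x : Fin 1 → ℝ => zeroExt F (x 0))
        BoxAdditiveMap.volume (C.toSubordinate r) - y| ≤ ε / 2 := by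
    intro π hp hH hs
    set π' := TaggedPrepartition.embedBox _ _ hle π with hπ'
    have hU : π'.iUnion = (box a b hab : Set (Fin 1 → ℝ)) := hp.iUnion_eq
    have hC' : C.iUnion = (box l u hlu : Set (Fin 1 → ℝ)) \ π'.iUnion := by
      rw [hC, Prepartition.iUnion_compl, Prepartition.iUnion_single, hU]
    have := hr _ hsp (π'.unionComplToSubordinate C hC' r)
      (TaggedPrepartition.isPartition_unionComplToSubordinate _ _ _ _)
      (TaggedPrepartition.IsHenstock.disjUnion (π₁ := π') hH (C.isHenstock_toSubordinate r) _)
      (TaggedPrepartition.IsSubordinate.disjUnion (π₁ := π') hs (C.isSubordinate_toSubordinate r) _)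
    rw [TaggedPrepartition.unionComplToSubordinate, integralSum_disjUnion] at this
    exact this
  refine ⟨fun _ => r, fun _ => IntegrationParams.rCond_of_bRiemann_eq_false _ rfl,
    fun c₁ c₂ π₁ π₂ h₁ p₁ h₂ p₂ => ?_⟩
  have k1 := abs_le.1 (key π₁ p₁ (h₁.2 rfl) h₁.1)
  have k2 := abs_le.1 (key π₂ p₂ (h₂.2 rfl) h₂.1)
  rw [Real.dist_eq, abs_le]
  constructor <;> linarith [k1.1, k1.2, k2.1, k2.2]

/-- A function that is integrable over `I` has a bounded indefinite integral. -/
lemma HKIntegrableOn.exists_isIndefinite {I : Set ℝ} (hI' : I.Nontrivial) {F : I → ℝ}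
    (hF : HKIntegrableOn F) :
    ∃ P, IsIndefinite (zeroExt F) (hull I) P ∧ ∃ C, ∀ x ∈ hull I, |P x| ≤ C := by
  obtain ⟨P, hP⟩ := LDPrimitive.exists_isIndefinite (ordConnected_hull I)
    fun a b hab h => hF.exists_hasHKIntegral hab h
  refine ⟨P, hP, ?_⟩
  obtain ⟨y, hy⟩ := hF
  obtain ⟨r, R, hr⟩ := hy 1 one_pos
  -- A partition fine for both the global and the local gauge compares `y` with `P u - P l`, at a
  -- cost of `1` each.
  have hspan : ∀ (l u : ℝ) (h : l < u), Spans I R (box l u h) → l ∈ hull I → u ∈ hull I →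
      |P u - P l - y| ≤ 2 := by
    intro l u h hsp hl hu
    have hi := hP l u h ((ordConnected_hull I).out hl hu)
    obtain ⟨r', hr'⟩ := hasHKIntegral_iff.1 hi 1 one_pos
    obtain ⟨π, hp, hH, hs⟩ := exists_partition (box l u h) fun x => min (r x) (r' x)
    have h1 := abs_le.1 (hr _ hsp π hp hH (hs.mono fun x _ => min_le_left _ _))
    have h2 := abs_le.1 (hr' π hp hH (hs.mono fun x _ => min_le_right _ _))
    rw [abs_le]
    constructor <;> linarith [h1.1, h1.2, h2.1, h2.2]
  obtain ⟨p, hp, q, hq, hpq⟩ := hI'.exists_lt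
  obtain ⟨l, u, hlu, hsp, -, -, hl, hu⟩ := exists_spans R hpq (subset_hull I hp)
    (subset_hull I hq)
  obtain ⟨M, hM⟩ := isCompact_Icc.exists_bound_of_continuousOn (s := Icc l u)
    (hP.mono ((ordConnected_hull I).out hl hu)).continuousOn
  -- Compactness bounds `P` on `[l, u]`. A point outside lies toward an infinite end, and the
  -- interval from it to the opposite endpoint still spans `I`, so `hspan` applies.
  refine ⟨M + |y| + 2, fun x hx => ?_⟩
  have hMl := abs_le.1 (hM l (left_mem_Icc.2 hlu.le))
  have hMu := abs_le.1 (hM u (right_mem_Icc.2 hlu.le))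
  have hy' := abs_le.1 (le_refl |y|)
  rcases lt_or_ge x l with hxl | hxl
  · have hb : ¬ BddBelow I := fun hb => by
      have e : l = sInf I := hsp.1 hb
      linarith [hx.1 hb]
    have := abs_le.1 (hspan x u (hxl.trans hlu) ⟨fun h => (hb h).elim,
      fun h => hxl.le.trans (hsp.2.1 h), hsp.2.2.1, hsp.2.2.2⟩ hx hu)
    rw [abs_le]
    constructor <;> linarith [this.1, this.2, hMu.1, hMu.2, hy'.1, hy'.2]
  rcases lt_or_ge u x with hux | hux
  · have hb : ¬ BddAbove I := fun hb => by
      have e : u = sSup I := hsp.2.2.1 hb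
      linarith [hx.2 hb]
    have := abs_le.1 (hspan l x (hlu.trans hux) ⟨hsp.1, hsp.2.1, fun h => (hb h).elim,
      fun h => (hsp.2.2.2 h).trans hux.le⟩ hl hx)
    rw [abs_le]
    constructor <;> linarith [this.1, this.2, hMl.1, hMl.2, hy'.1, hy'.2]
  · have := hM x ⟨hxl, hux⟩
    rw [Real.norm_eq_abs] at this
    linarith [abs_nonneg y]

lemma countable_zeroExt_ne_zero {I : Set ℝ} {F : I → ℝ} (hF : {t | F t ≠ 0}.Countable) :
    {x | zeroExt F x ≠ 0}.Countable := by
  refine (hF.image Subtype.val).mono fun x hx => ?_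
  by_cases h : ∃ t : I, t.1 = x
  · obtain ⟨t, rfl⟩ := h
    refine ⟨t, ?_, rfl⟩
    simpa [zeroExt] using hx
  · exact (hx (by rw [zeroExt, Function.extend_apply' _ _ _ h]; rfl)).elim

/-- A function that vanishes outside a countable set is integrable over `I`. -/
lemma hkIntegrableOn_of_countable {I : Set ℝ} {F : I → ℝ} (hF : {t | F t ≠ 0}.Countable) :
    HKIntegrableOn F := by
  classical
  set h := zeroExt F with hh
  have hc : {x : Fin 1 → ℝ | h (x 0) ≠ 0}.Countable :=
    (countable_zeroExt_ne_zero hF).preimage_of_injOn (f := fun x : Fin 1 → ℝ => x 0)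
      fun x _ y _ hxy => funext fun i => by rw [Subsingleton.elim i 0]; exact hxy
  refine ⟨0, fun ε hε => ?_⟩
  -- With radius `e x / (|h (x 0)| + 1)` a box tagged at `x` contributes at most `2 * e x`, and in
  -- dimension one a point tags at most two boxes of a Henstock partition: hence `ε / 4`. The
  -- estimate holds on every box, so `R = 0` suffices.
  obtain ⟨e, he, hsum⟩ := hc.exists_pos_forall_sum_le (ε := ε / 4) (by positivity)
  have hpos : ∀ x : Fin 1 → ℝ, 0 < e x / (|h (x 0)| + 1) := fun x =>
    div_pos (he x) (by positivity)
  refine ⟨fun x => ⟨_, hpos x⟩, 0, fun J _ π _ hH hs => ?_⟩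
  rw [integralSum_volume, sub_zero, ← hh]
  set w : (Fin 1 → ℝ) → ℝ := fun x => if h (x 0) ≠ 0 then 2 * e x else 0 with hw
  have hw0 : ∀ x, 0 ≤ w x := fun x => by
    simp only [hw]; split_ifs
    · linarith [he x]
    · exact le_rfl
  calc _ ≤ ∑ K ∈ π.boxes, w (π.tag K) := by
        refine (Finset.abs_sum_le_sum_abs _ _).trans (Finset.sum_le_sum fun K hK => ?_)
        by_cases h0 : h (π.tag K 0) = 0
        · rw [h0, mul_zero, abs_zero]; exact hw0 _
        · have hup : K.upper 0 - K.lower 0 ≤ 2 * (e (π.tag K) / (|h (π.tag K 0)| + 1)) := by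
            have h1 := (dist_le_pi_dist _ _ 0).trans (hs K hK K.upper_mem_Icc)
            have h2 := (dist_le_pi_dist _ _ 0).trans (hs K hK K.lower_mem_Icc)
            rw [Real.dist_eq] at h1 h2
            have h1 := (abs_le.1 h1).2
            have h2 := (abs_le.1 h2).1
            simp only at h1 h2
            linarith
          simp only [hw]
          rw [if_pos h0, abs_mul, abs_of_nonneg (sub_nonneg.2 (K.lower_le_upper 0))]
          have hpp : 0 < |h (π.tag K 0)| + 1 := by positivity
          calc _ ≤ 2 * (e (π.tag K) / (|h (π.tag K 0)| + 1)) * (|h (π.tag K 0)| + 1) := by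
                gcongr
                · have := hpos (π.tag K); positivity
                · linarith
            _ = 2 * e (π.tag K) := by field_simp
    _ = ∑ x ∈ π.boxes.image π.tag, (π.boxes.filter fun K => π.tag K = x).card • w x :=
        Finset.sum_comp w π.tag
    _ ≤ ∑ x ∈ π.boxes.image π.tag, 2 * w x := by
        refine Finset.sum_le_sum fun x _ => ?_
        rw [nsmul_eq_mul]
        gcongr
        · exact hw0 x
        · have := hH.card_filter_tag_eq_le x
          simp only [Fintype.card_fin, pow_one] at this
          exact_mod_cast this
    _ = 4 * ∑ x ∈ (π.boxes.image π.tag).filter fun x => h (x 0) ≠ 0, e x := by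
        rw [Finset.sum_filter, Finset.mul_sum]
        refine Finset.sum_congr rfl fun x _ => ?_
        simp only [hw]
        split_ifs <;> ring
    _ ≤ 4 * (ε / 4) := by
        gcongr
        exact hsum _ fun x hx => (Finset.mem_filter.1 hx).2
    _ = ε := by ring

/-- Functions are integrable over a bounded interval when they are integrable over its closure. -/
lemma hkIntegrableOn_of_bounded {I : Set ℝ} (hb : BddBelow I) (ha : BddAbove I) {F : I → ℝ}
    (h : sInf I < sSup I) {y : ℝ} (hF : HasHKIntegral (zeroExt F) (sInf I) (sSup I) h y) :
    HKIntegrableOn F := by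
  refine ⟨y, fun ε hε => ?_⟩
  obtain ⟨r, hr⟩ := hasHKIntegral_iff.1 hF ε hε
  refine ⟨r, 0, fun J hJ => ?_⟩
  -- A bounded `I` has only one spanning box.
  have e : J = box (sInf I) (sSup I) h := by
    rw [← box_eta J]
    congr 1
    · exact hJ.1 hb
    · exact hJ.2.2.1 ha
  subst e
  exact hr

/-- Constants are integrable over bounded intervals. -/
lemma hkIntegrableOn_const {I : Set ℝ} (hI : I.OrdConnected) (hI' : I.Nontrivial)
    (hb : BddBelow I) (ha : BddAbove I) (c : ℝ) : HKIntegrableOn (fun _ : I => c) := by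
  obtain ⟨p, hp, q, hq, hpq⟩ := hI'.exists_lt
  have hlt : sInf I < sSup I := ((csInf_le hb hp).trans_lt hpq).trans_le (le_csSup ha hq)
  have e : zeroExt (fun _ : I => c) = I.indicator fun _ => c := by
    ext x
    by_cases hx : x ∈ I
    · rw [indicator_of_mem hx]
      exact Subtype.val_injective.extend_apply (fun _ : I => c) 0 ⟨x, hx⟩
    · rw [indicator_of_notMem hx, zeroExt, Function.extend_apply']
      · rfl
      · rintro ⟨t, rfl⟩; exact hx t.2
  refine hkIntegrableOn_of_bounded hb ha hlt
    (hasHKIntegral_of_integrableOn (hab := hlt) ?_)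
  rw [e]
  exact (MeasureTheory.integrableOn_const (by simp)).indicator hI.measurableSet

end LDPrimitive

namespace LDPrimitive

variable {I : Set ℝ}

@[simp] lemma zeroExt_coe (F : I → ℝ) (t : I) : zeroExt F t = F t :=
  Subtype.val_injective.extend_apply F 0 t

lemma zeroExt_of_mem (F : I → ℝ) {x : ℝ} (hx : x ∈ I) : zeroExt F x = F ⟨x, hx⟩ :=
  zeroExt_coe F ⟨x, hx⟩

/-! ### One-sided limits in an interval -/

lemma exists_not_isMin (hI' : I.Nontrivial) : ∃ c : I, ¬ IsMin c := by
  obtain ⟨p, hp, q, hq, hpq⟩ := hI'.exists_lt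
  exact ⟨⟨q, hq⟩, fun h => (h.not_lt (b := ⟨p, hp⟩)) hpq⟩

lemma exists_not_isMin_lt (hI : I.OrdConnected) {c : I} (hc : ¬ IsMin c) :
    ∃ t : I, ¬ IsMin t ∧ t < c := by
  rw [not_isMin_iff] at hc
  obtain ⟨p, hp⟩ := hc
  obtain ⟨t, h1, h2⟩ := exists_between hp
  exact ⟨t, fun h => h.not_lt h1, h2⟩

/-- Removes `EReal`: all kinds of left end, finite or infinite, attained or not, are treated by one
basis inside `I`. -/
lemma infRight_hasBasis (hI : I.OrdConnected) (hI' : I.Nontrivial) :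
    (infRight I).HasBasis (fun c : I => ¬ IsMin c) fun c => {t | ¬ IsMin t ∧ t < c} := by
  set a : EReal := ⨅ t : I, ((t : ℝ) : EReal) with ha
  have hlt : ∀ t : I, ¬ IsMin t → a < ((t : ℝ) : EReal) := fun t ht => by
    obtain ⟨p, hp⟩ := not_isMin_iff.1 ht
    exact (iInf_le _ p).trans_lt (EReal.coe_lt_coe_iff.2 hp)
  have hmin : ∀ t : I, a < ((t : ℝ) : EReal) → ¬ IsMin t := fun t ht hm =>
    ht.not_ge (le_iInf fun s => EReal.coe_le_coe_iff.2 (hm.isBot s))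
  obtain ⟨q, hq⟩ := exists_not_isMin hI'
  refine ((nhdsGT_basis_of_exists_gt ⟨_, hlt q hq⟩).comap _).to_hasBasis ?_ ?_
  · intro x hx
    obtain ⟨t, ht⟩ := iInf_lt_iff.1 hx
    -- The minimum itself cannot serve as bound, so it is replaced by a point strictly between it
    -- and `min x q`.
    by_cases hm : IsMin t
    · have htq : t < q := lt_of_le_of_ne (hm.isBot q) fun h => hq (h ▸ hm)
      obtain ⟨z, hz1, hz2⟩ := EReal.lt_iff_exists_real_btwn.1
        (lt_min ht (EReal.coe_lt_coe_iff.2 htq))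
      have hz1 := EReal.coe_lt_coe_iff.1 hz1
      have hzq := EReal.coe_lt_coe_iff.1 (hz2.trans_le (min_le_right _ _))
      refine ⟨⟨z, hI.out t.2 q.2 ⟨hz1.le, hzq.le⟩⟩, fun h => h.not_lt (b := t) hz1, fun s hs => ?_⟩
      exact ⟨hlt s hs.1, (EReal.coe_lt_coe_iff.2 hs.2).trans (hz2.trans_le (min_le_left _ _))⟩
    · exact ⟨t, hm, fun s hs => ⟨hlt s hs.1, (EReal.coe_lt_coe_iff.2 hs.2).trans ht⟩⟩
  · intro c hc
    exact ⟨_, hlt c hc, fun s hs => ⟨hmin s hs.1, EReal.coe_lt_coe_iff.1 hs.2⟩⟩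

lemma infRight_neBot (hI : I.OrdConnected) (hI' : I.Nontrivial) : (infRight I).NeBot :=
  (infRight_hasBasis hI hI').neBot_iff.2 fun hc => exists_not_isMin_lt hI hc

/-- Makes the condition at an existing minimum and the limit at `inf I` statements about the same
filter. -/
lemma infRight_eq_nhdsGT (hI : I.OrdConnected) (hI' : I.Nontrivial) {m : I} (hm : IsMin m) :
    infRight I = 𝓝[>] m := by
  have hiff : ∀ t : I, ¬ IsMin t ↔ m < t := fun t =>
    ⟨fun h => lt_of_le_of_ne (hm.isBot t) fun e => h (e ▸ hm),
      fun h h' => h'.not_lt h⟩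
  obtain ⟨q, hq⟩ := exists_not_isMin hI'
  have hb := infRight_hasBasis hI hI'
  simp only [hiff] at hb
  exact hb.eq_of_same_basis (nhdsGT_basis_of_exists_gt ⟨q, (hiff q).1 hq⟩)

lemma tendsto_infRight_iff (hI : I.OrdConnected) (hI' : I.Nontrivial) {F : I → ℝ} {l : ℝ} :
    Tendsto F (infRight I) (𝓝 l) ↔
      ∀ ε > 0, ∃ c : I, ¬ IsMin c ∧ ∀ t : I, ¬ IsMin t → t < c → |F t - l| < ε := by
  rw [(infRight_hasBasis hI hI').tendsto_iff Metric.nhds_basis_ball]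
  simp only [mem_ofPred_eq, Metric.mem_ball, Real.dist_eq, and_imp]

lemma tendsto_nhdsLT_iff (hI : I.OrdConnected) {t : I} (ht : ¬ IsMin t) {F : I → ℝ} {l : ℝ} :
    Tendsto F (𝓝[<] t) (𝓝 l) ↔ ∀ ε > 0, ∃ s < t, ∀ x : I, s < x → x < t → |F x - l| < ε := by
  rw [(nhdsLT_basis_of_exists_lt (not_isMin_iff.1 ht)).tendsto_iff Metric.nhds_basis_ball]
  simp only [mem_Ioo, Metric.mem_ball, Real.dist_eq, and_imp]

/-- A left continuous function is nearly constant on a short interval ending at `t`. -/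
lemma exists_Icc_near (hI : I.OrdConnected) {t : I} (ht : ¬ IsMin t) {F : I → ℝ}
    (hF : Tendsto F (𝓝[<] t) (𝓝 (F t))) {ε : ℝ} (hε : 0 < ε) :
    ∃ s < t, ∀ x : I, s ≤ x → x ≤ t → |F x - F t| < ε := by
  obtain ⟨s, hs, h⟩ := (tendsto_nhdsLT_iff hI ht).1 hF ε hε
  obtain ⟨s', h1, h2⟩ := exists_between hs
  refine ⟨s', h2, fun x hx hxt => ?_⟩
  rcases hxt.lt_or_eq with hlt | rfl
  · exact h x (h1.trans_le hx) hlt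
  · simpa using hε

/-! ### The Alexiewicz norm -/

lemma HKIntegrableOn.hasHKIntegral {F : I → ℝ} (hF : HKIntegrableOn F) {a b : ℝ} (hab : a < b)
    (h : Icc a b ⊆ I) : HasHKIntegral (zeroExt F) a b hab (hkIntegral (zeroExt F) a b hab) := by
  obtain ⟨y, hy⟩ := hF.exists_hasHKIntegral hab (h.trans (subset_hull I))
  rwa [hy.hkIntegral_eq]

lemma alexSet_nonempty (hI : I.OrdConnected) (hI' : I.Nontrivial) (F : I → ℝ) :
    (alexSet F).Nonempty := by
  obtain ⟨p, hp, q, hq, hpq⟩ := hI'.exists_lt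
  exact ⟨_, p, q, hpq, hI.out hp hq, rfl⟩

lemma HKIntegrableOn.bddAbove_alexSet (hI' : I.Nontrivial) {F : I → ℝ} (hF : HKIntegrableOn F) :
    BddAbove (alexSet F) := by
  obtain ⟨P, hP, C, hC⟩ := hF.exists_isIndefinite hI'
  refine ⟨2 * C, ?_⟩
  rintro _ ⟨a, b, hab, h, rfl⟩
  rw [(hP a b hab (h.trans (subset_hull I))).hkIntegral_eq]
  have h1 := abs_le.1 (hC a (subset_hull I (h (left_mem_Icc.2 hab.le))))
  have h2 := abs_le.1 (hC b (subset_hull I (h (right_mem_Icc.2 hab.le))))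
  rw [abs_le]
  constructor <;> linarith [h1.1, h1.2, h2.1, h2.2]

lemma HKIntegrableOn.isLUB_alexNorm (hI : I.OrdConnected) (hI' : I.Nontrivial) {F : I → ℝ}
    (hF : HKIntegrableOn F) : IsLUB (alexSet F) (alexNorm F) :=
  isLUB_csSup (alexSet_nonempty hI hI' F) (hF.bddAbove_alexSet hI')

lemma HKIntegrableOn.abs_hkIntegral_le (hI : I.OrdConnected) (hI' : I.Nontrivial) {F : I → ℝ}
    (hF : HKIntegrableOn F) {a b : ℝ} (hab : a < b) (h : Icc a b ⊆ I) :
    |hkIntegral (zeroExt F) a b hab| ≤ alexNorm F :=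
  (hF.isLUB_alexNorm hI hI').1 ⟨a, b, hab, h, rfl⟩

lemma alexNorm_nonneg (F : I → ℝ) : 0 ≤ alexNorm F :=
  Real.sSup_nonneg (by rintro _ ⟨a, b, hab, h, rfl⟩; exact abs_nonneg _)

lemma hkIntegral_zeroExt_smul (c : ℝ) (F : I → ℝ) {a b : ℝ} (hab : a < b) :
    hkIntegral (zeroExt (c • F)) a b hab = c * hkIntegral (zeroExt F) a b hab := by
  rw [zeroExt_smul]
  exact integral_smul c

open scoped Pointwise in
lemma alexNorm_smul (c : ℝ) (F : I → ℝ) : alexNorm (c • F) = |c| * alexNorm F := by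
  have : alexSet (c • F) = |c| • alexSet F := by
    ext s
    simp only [alexSet, mem_ofPred_eq, Set.mem_smul_set, smul_eq_mul]
    constructor
    · rintro ⟨a, b, hab, h, rfl⟩
      exact ⟨_, ⟨a, b, hab, h, rfl⟩, by rw [hkIntegral_zeroExt_smul, abs_mul]⟩
    · rintro ⟨_, ⟨a, b, hab, h, rfl⟩, rfl⟩
      exact ⟨a, b, hab, h, by rw [hkIntegral_zeroExt_smul, abs_mul]⟩
  rw [alexNorm, this, Real.sSup_smul_of_nonneg (abs_nonneg c)]
  rfl

lemma HKIntegrableOn.hasHKIntegral_add {F G : I → ℝ} (hF : HKIntegrableOn F)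
    (hG : HKIntegrableOn G) {a b : ℝ} (hab : a < b) (h : Icc a b ⊆ I) :
    hkIntegral (zeroExt (F + G)) a b hab =
      hkIntegral (zeroExt F) a b hab + hkIntegral (zeroExt G) a b hab := by
  rw [zeroExt_add]
  exact ((hF.hasHKIntegral hab h).add (hG.hasHKIntegral hab h)).hkIntegral_eq

lemma HKIntegrableOn.alexNorm_add_le (hI : I.OrdConnected) (hI' : I.Nontrivial) {F G : I → ℝ}
    (hF : HKIntegrableOn F) (hG : HKIntegrableOn G) :
    alexNorm (F + G) ≤ alexNorm F + alexNorm G := by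
  refine csSup_le (alexSet_nonempty hI hI' _) ?_
  rintro _ ⟨a, b, hab, h, rfl⟩
  rw [hF.hasHKIntegral_add hG hab h]
  exact (abs_add_le _ _).trans (add_le_add (hF.abs_hkIntegral_le hI hI' hab h)
    (hG.abs_hkIntegral_le hI hI' hab h))

lemma hkIntegrableOn_of_mem_Dlc {F : I → ℝ} (hF : F ∈ Dlc I) : HKIntegrableOn F := hF.1.2.1

/-- A function of `𝒟^{lc}(I)` with nonnegative integrals is nonnegative. -/
lemma nonneg_of_hkIntegral_nonneg (hI : I.OrdConnected) (hI' : I.Nontrivial) {F : I → ℝ}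
    (hF : F ∈ Dlc I)
    (h : ∀ (a b : ℝ) (hab : a < b), Icc a b ⊆ I → 0 ≤ hkIntegral (zeroExt F) a b hab) (x : I) :
    0 ≤ F x := by
  have key : ∀ t : I, ¬ IsMin t → 0 ≤ F t := by
    intro t ht
    by_contra! hneg
    -- On `[s, t]` the function stays below `F t / 2 < 0`, so its integral there would be negative.
    obtain ⟨s, hs, hnear⟩ := exists_Icc_near hI ht (hF.2.1 t ht)
      (ε := - F t / 2) (by linarith)
    have hst : (s : ℝ) < t := hs
    have hsub := hI.out s.2 t.2
    have := ((hkIntegrableOn_of_mem_Dlc hF).hasHKIntegral hst hsub).mono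
      (hasHKIntegral_const (F t / 2)) fun x hx => by
        rw [zeroExt_of_mem F (hsub hx)]
        have := (abs_lt.1 (hnear ⟨x, hsub hx⟩ hx.1 hx.2)).2
        linarith
    nlinarith [h s t hst hsub]
  by_cases hx : IsMin x
  · have := infRight_neBot hI hI'
    rw [infRight_eq_nhdsGT hI hI' hx] at this
    refine ge_of_tendsto (hF.2.2 x hx) ?_
    filter_upwards [self_mem_nhdsWithin] with t ht
    exact key t fun h => h.not_lt ht
  · exact key x hx

/-- Any space of functions of `𝒟^{lc}(I)` is an ordered normed space. -/
lemma isOrderedNormedSpace_of_le_Dlc (hI : I.OrdConnected) (hI' : I.Nontrivial)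
    {S : Submodule ℝ (I → ℝ)} (hS : S ≤ Dlc I) :
    IsOrderedNormedSpace (fun F G : S => ∀ x : I, (F : I → ℝ) x ≤ (G : I → ℝ) x)
      (fun F : S => alexNorm (F : I → ℝ)) := by
  have hint : ∀ F : S, HKIntegrableOn (F : I → ℝ) := fun F => hkIntegrableOn_of_mem_Dlc (hS F.2)
  have hnn : ∀ F : S, alexNorm (F : I → ℝ) = 0 → ∀ x, 0 ≤ (F : I → ℝ) x := fun F h0 =>
    nonneg_of_hkIntegral_nonneg hI hI' (hS F.2) fun a b hab h => by
      have := (hint F).abs_hkIntegral_le hI hI' hab h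
      rw [h0] at this
      exact (abs_nonpos_iff.1 this).ge
  have hsmul : ∀ (k : ℝ) (F : S), alexNorm ((k • F : S) : I → ℝ) = |k| * alexNorm (F : I → ℝ) :=
    fun k F => alexNorm_smul k _
  refine ⟨fun F x => le_rfl, fun F G h1 h2 => Subtype.ext (funext fun x => (h1 x).antisymm (h2 x)),
    fun F G K h1 h2 x => (h1 x).trans (h2 x), fun F G K h x => add_le_add_left (h x) _,
    fun k F G hk h x => mul_le_mul_of_nonneg_left (h x) hk, fun F => alexNorm_nonneg _,
    fun F => ⟨fun h0 => ?_, ?_⟩, hsmul, fun F G => (hint F).alexNorm_add_le hI hI' (hint G),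
    fun F hF x => ?_⟩
  · refine Subtype.ext (funext fun x => (le_antisymm ?_ (hnn F h0 x)))
    have := hnn ((-1 : ℝ) • F) (by rw [hsmul, h0, mul_zero]) x
    simpa using this
  · rintro rfl
    simpa using hsmul 0 0
  -- Closedness of the cone: `∫ G ≥ 0` and `|∫ (G - F)| < ε` give `∫ F > -ε` for every `ε`.
  · refine nonneg_of_hkIntegral_nonneg hI hI' (hS F.2) (fun a b hab h => ?_) x
    refine le_of_forall_pos_lt_add fun ε hε => ?_
    obtain ⟨G, hG, hlt⟩ := hF ε hε
    have h1 : 0 ≤ hkIntegral (zeroExt (G : I → ℝ)) a b hab := by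
      have := (hasHKIntegral_const (hab := hab) 0).mono ((hint G).hasHKIntegral hab h)
        fun x hx => by rw [zeroExt_of_mem _ (h hx)]; exact hG _
      simpa using this
    have h2 := ((hint (G - F)).abs_hkIntegral_le hI hI' hab h).trans_lt hlt
    have h3 := (hint (G - F)).hasHKIntegral_add (hint F) hab h
    have h4 : ((G - F : S) : I → ℝ) + (F : I → ℝ) = G := by simp
    rw [h4] at h3
    linarith [(abs_lt.1 h2).2]

end LDPrimitive

namespace LDPrimitive

variable {I : Set ℝ}

/-! ### Test functions -/

/-- Including the points `p < q` of `I` keeps the interval nondegenerate even if `K` is empty or a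
single point. -/
lemma exists_Icc_subset (hI : I.OrdConnected) (hI' : I.Nontrivial) {K : Set ℝ} (hK : IsCompact K)
    (hKI : K ⊆ I) : ∃ a b : ℝ, a < b ∧ K ⊆ Icc a b ∧ Icc a b ⊆ I := by
  obtain ⟨p, hp, q, hq, hpq⟩ := hI'.exists_lt
  rcases K.eq_empty_or_nonempty with rfl | hne
  · exact ⟨p, q, hpq, empty_subset _, hI.out hp hq⟩
  have h1 := hKI (hK.sInf_mem hne)
  have h2 := hKI (hK.sSup_mem hne)
  refine ⟨min p (sInf K), max q (sSup K), (min_le_left _ _).trans_lt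
    (hpq.trans_le (le_max_left _ _)), fun x hx => ⟨(min_le_right _ _).trans
      (csInf_le hK.bddBelow hx), (le_csSup hK.bddAbove hx).trans (le_max_right _ _)⟩, ?_⟩
  refine hI.out ?_ ?_
  · rcases min_choice p (sInf K) with h | h <;> rw [h] <;> assumption
  · rcases max_choice q (sSup K) with h | h <;> rw [h] <;> assumption

lemma TestFun.exists_Icc (hI : I.OrdConnected) (hI' : I.Nontrivial) (φ : TestFun I) :
    ∃ a b : ℝ, a < b ∧ tsupport (φ : ℝ → ℝ) ⊆ Icc a b ∧ Icc a b ⊆ I :=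
  exists_Icc_subset hI hI' φ.2.2.1 φ.2.2.2

lemma TestFun.contDiff (φ : TestFun I) : ContDiff ℝ (⊤ : ℕ∞) (φ : ℝ → ℝ) := φ.2.1

lemma TestFun.contDiff_deriv (φ : TestFun I) : ContDiff ℝ 1 (deriv (φ : ℝ → ℝ)) :=
  ContDiff.deriv' (n := 1) (by exact_mod_cast contDiff_infty.1 (TestFun.contDiff φ) 2)

lemma intervalIntegral_eq_integral {g : ℝ → ℝ} {a b : ℝ} (hab : a ≤ b)
    (hg : ∀ x, x ∉ Icc a b → g x = 0) : ∫ x in a..b, g x = ∫ x, g x := by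
  rw [intervalIntegral.integral_of_le hab, ← MeasureTheory.integral_Icc_eq_integral_Ioc,
    MeasureTheory.setIntegral_eq_integral_of_forall_compl_eq_zero hg]

lemma eq_zero_of_notMem {g : ℝ → ℝ} {s : Set ℝ} (h : tsupport g ⊆ s) {x : ℝ} (hx : x ∉ s) :
    g x = 0 := image_eq_zero_of_notMem_tsupport fun h' => hx (h h')

/-- A continuous function supported in `[a, b]` vanishes at `a` and `b`. -/
lemma eq_zero_of_notMem_Ioo {g : ℝ → ℝ} (hg : Continuous g) {a b : ℝ}
    (h : tsupport g ⊆ Icc a b) {x : ℝ} (hx : x ∉ Ioo a b) : g x = 0 := by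
  by_contra h0
  have : Function.support g ⊆ interior (Icc a b) :=
    interior_maximal ((subset_tsupport g).trans h) hg.isOpen_support
  rw [interior_Icc] at this
  exact hx (this h0)

lemma TestFun.integral_deriv_eq_zero (φ : TestFun I) : ∫ x, deriv (φ : ℝ → ℝ) x = 0 :=
  MeasureTheory.integral_eq_zero_of_hasDerivAt_of_integrable
    (f := (φ : ℝ → ℝ)) (fun x => ((TestFun.contDiff φ).differentiable (by simp) x).hasDerivAt)
    ((TestFun.contDiff_deriv φ).continuous.integrable_of_hasCompactSupport φ.2.2.1.deriv)
    ((TestFun.contDiff φ).continuous.integrable_of_hasCompactSupport φ.2.2.1)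

/-! ### Primitives -/

lemma IsPrimitive.sub {H K : I → ℝ} {f g : TestFun I →ₗ[ℝ] ℝ} (hH : IsPrimitive H f)
    (hK : IsPrimitive K g) : IsPrimitive (H - K) (f - g) := fun φ a b hab h1 h2 => by
  have := (hH φ a b hab h1 h2).sub (hK φ a b hab h1 h2)
  convert! this using 1
  · ext t
    have : zeroExt (H - K) = zeroExt H - zeroExt K := by
      rw [sub_eq_add_neg, zeroExt_add, ← neg_one_smul ℝ K, zeroExt_smul, neg_one_smul,
        ← sub_eq_add_neg]
    rw [this, Pi.sub_apply, sub_mul]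
  · simp; ring

lemma IsPrimitive.add {H K : I → ℝ} {f g : TestFun I →ₗ[ℝ] ℝ} (hH : IsPrimitive H f)
    (hK : IsPrimitive K g) : IsPrimitive (H + K) (f + g) := fun φ a b hab h1 h2 => by
  have := (hH φ a b hab h1 h2).add (hK φ a b hab h1 h2)
  convert! this using 1
  · ext t; rw [zeroExt_add, Pi.add_apply, add_mul]
  · simp; ring

lemma IsPrimitive.smul {H : I → ℝ} {f : TestFun I →ₗ[ℝ] ℝ} (hH : IsPrimitive H f) (c : ℝ) :
    IsPrimitive (c • H) (c • f) := fun φ a b hab h1 h2 => by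
  have := (hH φ a b hab h1 h2).const_mul c
  convert! this using 1
  · ext t; rw [zeroExt_smul, Pi.smul_apply, smul_eq_mul, mul_assoc]
  · simp

/-- A distribution is determined by a primitive. -/
lemma IsPrimitive.unique (hI : I.OrdConnected) (hI' : I.Nontrivial) {H : I → ℝ}
    {f g : TestFun I →ₗ[ℝ] ℝ} (hf : IsPrimitive H f) (hg : IsPrimitive H g) : f = g := by
  ext φ
  obtain ⟨a, b, hab, h1, h2⟩ := TestFun.exists_Icc hI hI' φ
  have h1 := tsupport_deriv_subset.trans h1
  exact neg_injective ((hf φ a b hab h1 h2).unique (hg φ a b hab h1 h2))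

/-- Constants are primitives of zero. -/
lemma isPrimitive_const (c : ℝ) : IsPrimitive (fun _ : I => c) 0 := fun φ a b hab h1 h2 => by
  have hc : Continuous (deriv (φ : ℝ → ℝ)) := (TestFun.contDiff_deriv φ).continuous
  have := (hasHKIntegral_of_continuousOn (hab := hab) hc.continuousOn).const_mul c
  rw [intervalIntegral_eq_integral hab.le fun x hx => eq_zero_of_notMem h1 hx,
    TestFun.integral_deriv_eq_zero φ, mul_zero] at this
  rw [LinearMap.zero_apply, neg_zero]
  exact this.congr fun x hx => by rw [zeroExt_of_mem _ (h2 hx)]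

/-! ### Smooth steps and the du Bois-Reymond lemma -/

/-- A smooth function rising from `0` to `1` on the interval `[c - ε, c]`. -/
noncomputable def smoothStep (c ε : ℝ) (t : ℝ) : ℝ := Real.smoothTransition ((t - c) / ε + 1)

lemma smoothStep_contDiff (c ε : ℝ) : ContDiff ℝ (⊤ : ℕ∞) (smoothStep c ε) :=
  Real.smoothTransition.contDiff.comp (by fun_prop)

lemma smoothStep_of_le {c ε t : ℝ} (hε : 0 < ε) (h : t ≤ c - ε) : smoothStep c ε t = 0 := by
  refine Real.smoothTransition.zero_of_nonpos ?_
  have : (t - c) / ε ≤ -1 := by rw [div_le_iff₀ hε]; linarith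
  linarith

lemma smoothStep_of_ge {c ε t : ℝ} (hε : 0 < ε) (h : c ≤ t) : smoothStep c ε t = 1 := by
  refine Real.smoothTransition.one_of_one_le ?_
  have : 0 ≤ (t - c) / ε := div_nonneg (by linarith) hε.le
  linarith

lemma smoothStep_deriv_nonneg {c ε : ℝ} (hε : 0 < ε) (t : ℝ) : 0 ≤ deriv (smoothStep c ε) t := by
  refine Monotone.deriv_nonneg fun x y hxy => Real.smoothTransition.monotone ?_
  gcongr

lemma smoothStep_deriv_eq_zero {c ε : ℝ} (hε : 0 < ε) {t : ℝ} (ht : t ∉ Icc (c - ε) c) :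
    deriv (smoothStep c ε) t = 0 := by
  rw [mem_Icc, not_and_or, not_le, not_le] at ht
  rcases ht with h | h
  · have : smoothStep c ε =ᶠ[𝓝 t] fun _ => 0 := by
      filter_upwards [Iio_mem_nhds h] with x hx using smoothStep_of_le hε (le_of_lt hx)
    rw [this.deriv_eq, deriv_const]
  · have : smoothStep c ε =ᶠ[𝓝 t] fun _ => 1 := by
      filter_upwards [Ioi_mem_nhds h] with x hx using smoothStep_of_ge hε (le_of_lt hx)
    rw [this.deriv_eq, deriv_const]

/-- Together with nonnegativity, this makes the derivative an averaging kernel on `[c - ε, c]`,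
which samples a left continuous function near `c`. -/
lemma hasHKIntegral_deriv_smoothStep {c ε a b : ℝ} (hε : 0 < ε) (ha : a ≤ c - ε) (hb : c ≤ b)
    (hab : a < b) : HasHKIntegral (deriv (smoothStep c ε)) a b hab 1 := by
  have hd := smoothStep_contDiff c ε
  have hc : Continuous (deriv (smoothStep c ε)) := hd.continuous_deriv (by simp)
  have := hasHKIntegral_of_continuousOn (hab := hab) hc.continuousOn
  rwa [intervalIntegral.integral_deriv_eq_sub (fun x _ => hd.differentiable (by simp) x)
    (hc.intervalIntegrable _ _), smoothStep_of_le hε ha, smoothStep_of_ge hε hb, sub_zero] at this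

/-- The **du Bois-Reymond lemma**: a left continuous function with distributional derivative zero
takes the same value at all points other than a possible minimum. -/
lemma IsPrimitive.eq_of_not_isMin (hI : I.OrdConnected) {F : I → ℝ}
    (hF : IsPrimitive F 0) (hc : ∀ t : I, ¬ IsMin t → Tendsto F (𝓝[<] t) (𝓝 (F t))) {c d : I}
    (hcm : ¬ IsMin c) (hdm : ¬ IsMin d) : F c = F d := by
  wlog H : ∀ c d : I, ¬ IsMin c → ¬ IsMin d → F d ≤ F c generalizing c d
  · refine (H ?_).elim
    clear c d hcm hdm H
    intro c d hcm hdm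
    refine le_of_forall_pos_lt_add fun η hη => ?_
    obtain ⟨s, hs, hsn⟩ := exists_Icc_near hI hcm (hc c hcm) (ε := η / 4) (by positivity)
    obtain ⟨u, hu, hun⟩ := exists_Icc_near hI hdm (hc d hdm) (ε := η / 4) (by positivity)
    have hs' : (s : ℝ) < c := hs
    have hu' : (u : ℝ) < d := hu
    set ε : ℝ := min (c - s) (d - u) with hεd
    have hε : 0 < ε := lt_min (sub_pos.2 hs') (sub_pos.2 hu')
    have hε1 : (s : ℝ) ≤ c - ε := by linarith [min_le_left ((c : ℝ) - s) (d - u)]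
    have hε2 : (u : ℝ) ≤ d - ε := by linarith [min_le_right ((c : ℝ) - s) (d - u)]
    set a : ℝ := min s u with ha
    set b : ℝ := max c d with hb
    have hac : a ≤ c - ε := (min_le_left _ _).trans hε1
    have had : a ≤ d - ε := (min_le_right _ _).trans hε2
    have hcb : (c : ℝ) ≤ b := le_max_left _ _
    have hdb : (d : ℝ) ≤ b := le_max_right _ _
    have hab : a < b := by linarith
    have hsub : Icc a b ⊆ I := by
      refine hI.out ?_ ?_
      · rcases min_choice (s : ℝ) u with h | h <;> rw [ha, h] <;> exact Subtype.prop _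
      · rcases max_choice (c : ℝ) d with h | h <;> rw [hb, h] <;> exact Subtype.prop _
    -- Both steps are `0` left of `a` and `1` right of `b`, so the difference has compact support,
    -- and `∫ F φ' = 0` is nearly `F c - F d`.
    set φ : ℝ → ℝ := fun t => smoothStep c ε t - smoothStep d ε t with hφ
    have hφs : tsupport φ ⊆ Icc a b := by
      refine closure_minimal (fun t ht => ?_) isClosed_Icc
      by_contra hn
      refine ht ?_
      rw [mem_Icc, not_and_or, not_le, not_le] at hn
      rcases hn with h | h
      · simp only [hφ]
        rw [smoothStep_of_le hε (by linarith), smoothStep_of_le hε (by linarith), sub_self]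
      · simp only [hφ]
        rw [smoothStep_of_ge hε (by linarith), smoothStep_of_ge hε (by linarith), sub_self]
    have hT : φ ∈ TestFun I := ⟨(smoothStep_contDiff _ _).sub (smoothStep_contDiff _ _),
      isCompact_Icc.of_isClosed_subset (isClosed_tsupport φ) hφs, hφs.trans hsub⟩
    have hderiv : ∀ t, deriv φ t = deriv (smoothStep c ε) t - deriv (smoothStep d ε) t := fun t =>
      deriv_fun_sub ((smoothStep_contDiff _ _).differentiable (by simp) t)
        ((smoothStep_contDiff _ _).differentiable (by simp) t)
    have h1 := hF ⟨φ, hT⟩ a b hab (tsupport_deriv_subset.trans hφs) hsub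
    have hgc := hasHKIntegral_deriv_smoothStep hε hac hcb hab
    have hgd := hasHKIntegral_deriv_smoothStep hε had hdb hab
    -- The kernels have mass one, so integrating the pointwise bound gives `F d - F c ≤ η / 2`.
    have hle := ((h1.sub (hgc.const_mul (F c))).add (hgd.const_mul (F d))).mono
      ((hgc.add hgd).const_mul (η / 4)) fun t ht => by
        have near : ∀ (e : I) (v : I), ((v : ℝ) ≤ e - ε) →
            (∀ x : I, v ≤ x → x ≤ e → |F x - F e| < η / 4) →
            |(zeroExt F t - F e) * deriv (smoothStep e ε) t| ≤
              η / 4 * deriv (smoothStep e ε) t := fun e v hv hnear => by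
          by_cases hte : t ∈ Icc (e - ε) (e : ℝ)
          · rw [abs_mul, abs_of_nonneg (smoothStep_deriv_nonneg hε t), zeroExt_of_mem F (hsub ht)]
            refine mul_le_mul_of_nonneg_right (hnear _ ?_ hte.2).le (smoothStep_deriv_nonneg hε t)
            exact hv.trans hte.1
          · rw [smoothStep_deriv_eq_zero hε hte]; simp
        have n1 := (abs_le.1 (near c s hε1 hsn)).2
        have n2 := (abs_le.1 (near d u hε2 hun)).1
        simp only [hderiv]
        linarith
    simp only [LinearMap.zero_apply] at hle
    linarith
  · exact le_antisymm (H d c hdm hcm) (H c d hcm hdm)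

lemma IsPrimitive.eq_const (hI : I.OrdConnected) (hI' : I.Nontrivial) {F : I → ℝ}
    (hF : IsPrimitive F 0) (hc : F ∈ Dlc I) : ∃ k, ∀ x, F x = k := by
  obtain ⟨c, hcm⟩ := exists_not_isMin hI'
  have key : ∀ t : I, ¬ IsMin t → F t = F c := fun t ht => hF.eq_of_not_isMin hI hc.2.1 ht hcm
  refine ⟨F c, fun x => ?_⟩
  by_cases hx : IsMin x
  · have := infRight_neBot hI hI'
    rw [infRight_eq_nhdsGT hI hI' hx] at this
    refine tendsto_nhds_unique (hc.2.2 x hx) (tendsto_const_nhds.congr' ?_)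
    filter_upwards [self_mem_nhdsWithin] with t ht
    exact (key t fun h => h.not_lt ht).symm
  · exact key x hx

/-- Two primitives in `𝒟^{lc}(I)` differ by a constant. -/
lemma IsPrimitive.sub_eq_const (hI : I.OrdConnected) (hI' : I.Nontrivial) {F G : I → ℝ}
    {f : TestFun I →ₗ[ℝ] ℝ} (hF : IsPrimitive F f) (hG : IsPrimitive G f) (hFl : F ∈ Dlc I)
    (hGl : G ∈ Dlc I) : ∃ k, ∀ x, F x - G x = k := by
  have := hF.sub hG
  rw [sub_self] at this
  exact this.eq_const hI hI' (sub_mem hFl hGl)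

/-- The constant difference is its own limit at `inf I`, which is `0`. -/
lemma IsPrimitive.eq_of_mem_Dlc0 (hI : I.OrdConnected) (hI' : I.Nontrivial) {F G : I → ℝ}
    {f : TestFun I →ₗ[ℝ] ℝ} (hF : IsPrimitive F f) (hG : IsPrimitive G f) (hFl : F ∈ Dlc0 I)
    (hGl : G ∈ Dlc0 I) : F = G := by
  obtain ⟨k, hk⟩ := hF.sub_eq_const hI hI' hG hFl.1 hGl.1
  have := infRight_neBot hI hI'
  have h1 : Tendsto (fun x => F x - G x) (infRight I) (𝓝 (0 - 0)) := hFl.2.sub hGl.2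
  simp only [hk, sub_zero] at h1
  have := tendsto_nhds_unique tendsto_const_nhds h1
  ext x
  linarith [hk x]

end LDPrimitive

namespace LDPrimitive

variable {I : Set ℝ}

/-! ### The left continuous representative -/

/-- A function and its left limit differ at countably many points only. -/
lemma countable_setOf_ne_leftLimit (hI : I.OrdConnected) {H G : I → ℝ}
    (hG : ∀ t : I, ¬ IsMin t → Tendsto H (𝓝[<] t) (𝓝 (G t))) : {t | H t ≠ G t}.Countable := by
  have hq : ∀ s t : I, s < t → ∃ q : ℚ, (s : ℝ) < q ∧ (q : ℝ) < t := fun s t h => exists_rat_btwn h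
  have h1 : {t : I | IsMin t}.Countable :=
    Set.Subsingleton.countable fun s hs t ht => le_antisymm (hs.isBot t) (ht.isBot s)
  -- If `H t ≠ G t`, the midpoint of the two values separates `H t` from all values of `H` on some
  -- `(q, t)` with `q` rational; for each `q` this happens at countably many `t`.
  have h2 := countable_iUnion fun q : ℚ =>
    countable_image_gt_image_Iio_within {x : I | (q : ℝ) < x} H
  have h3 := countable_iUnion fun q : ℚ =>
    countable_image_lt_image_Iio_within {x : I | (q : ℝ) < x} H
  refine (h1.union (h2.union h3)).mono fun t ht => ?_
  by_cases hm : IsMin t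
  · exact Or.inl hm
  refine Or.inr ?_
  rcases lt_or_gt_of_ne ht with hlt | hlt
  · obtain ⟨s, hs, hn⟩ := (tendsto_nhdsLT_iff hI hm).1 (hG t hm) ((G t - H t) / 2) (by linarith)
    obtain ⟨q, hq1, hq2⟩ := hq s t hs
    refine Or.inl (mem_iUnion.2 ⟨q, hq2, (G t + H t) / 2, by linarith, fun y hy hyt => ?_⟩)
    have := (abs_lt.1 (hn y (hq1.trans hy) hyt)).1
    linarith
  · obtain ⟨s, hs, hn⟩ := (tendsto_nhdsLT_iff hI hm).1 (hG t hm) ((H t - G t) / 2) (by linarith)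
    obtain ⟨q, hq1, hq2⟩ := hq s t hs
    refine Or.inr (mem_iUnion.2 ⟨q, hq2, (G t + H t) / 2, by linarith, fun y hy hyt => ?_⟩)
    have := (abs_lt.1 (hn y (hq1.trans hy) hyt)).2
    linarith

/-- Changing a primitive at countably many points does not affect its derivative. -/
lemma IsPrimitive.congr_countable {H G : I → ℝ} {f : TestFun I →ₗ[ℝ] ℝ} (hH : IsPrimitive H f)
    (hc : {t | H t ≠ G t}.Countable) : IsPrimitive G f := fun φ a b hab h1 h2 => by
  have hc' : {x | zeroExt (H - G) x * deriv (φ : ℝ → ℝ) x ≠ 0}.Countable :=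
    (countable_zeroExt_ne_zero (F := H - G) (by simpa [sub_ne_zero] using hc)).mono
      fun x hx => left_ne_zero_of_mul hx
  have := (hH φ a b hab h1 h2).sub (hasHKIntegral_zero_of_countable (hab := hab) hc')
  rw [sub_zero] at this
  refine this.congr fun x hx => ?_
  rw [zeroExt_of_mem _ (h2 hx), zeroExt_of_mem _ (h2 hx), zeroExt_of_mem _ (h2 hx), Pi.sub_apply]
  ring

/-- Every primitive in `𝒟^{lr}(I)` with limit zero at `inf I` has a representative in
`𝒟^{lc}_0(I)`. -/
lemma exists_leftContinuous (hI : I.OrdConnected) (hI' : I.Nontrivial) {H : I → ℝ}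
    (hH : H ∈ Dlr I) (h0 : Tendsto H (infRight I) (𝓝 0)) :
    ∃ G ∈ Dlc0 I, {t | H t ≠ G t}.Countable := by
  classical
  choose! L hL using hH.1
  -- The value `0` at a minimum agrees with the limit at `inf I` and so gives right continuity
  -- there.
  set G : I → ℝ := fun t => if IsMin t then 0 else L t with hGd
  have hG : ∀ t : I, ¬ IsMin t → Tendsto H (𝓝[<] t) (𝓝 (G t)) := fun t ht => by
    simp only [hGd, if_neg ht]; exact hL t ht
  have hcount := countable_setOf_ne_leftLimit hI hG
  -- Bounds for `H` on an interval pass to its left limits, so `G` inherits left continuity and the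
  -- limit at `inf I`.
  have close : ∀ (t : I), ¬ IsMin t → ∀ (s : I) (l ε : ℝ), s < t →
      (∀ x : I, s < x → x < t → |H x - l| < ε) → |G t - l| ≤ ε := by
    intro t ht s l ε hst h
    have : (𝓝[<] t).NeBot := nhdsLT_neBot_of_exists_lt ⟨s, hst⟩
    refine le_of_tendsto ((hG t ht).sub_const l).abs ?_
    filter_upwards [Ioo_mem_nhdsLT hst] with x hx using (h x hx.1 hx.2).le
  have hleft : ∀ t : I, ¬ IsMin t → Tendsto G (𝓝[<] t) (𝓝 (G t)) := by
    intro t ht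
    rw [tendsto_nhdsLT_iff hI ht]
    intro ε hε
    obtain ⟨s, hs, h⟩ := (tendsto_nhdsLT_iff hI ht).1 (hG t ht) (ε / 2) (half_pos hε)
    refine ⟨s, hs, fun x hsx hxt => ?_⟩
    have := close x (fun hm => hm.not_lt hsx) s (G t) (ε / 2) hsx
      fun y hy hyx => h y hy (hyx.trans hxt)
    linarith
  have hlim : Tendsto G (infRight I) (𝓝 0) := by
    rw [tendsto_infRight_iff hI hI'] at h0 ⊢
    intro ε hε
    obtain ⟨c, hc, h⟩ := h0 (ε / 2) (half_pos hε)
    refine ⟨c, hc, fun t ht htc => ?_⟩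
    obtain ⟨s, -, hst⟩ := exists_not_isMin_lt hI ht
    have := close t ht s 0 (ε / 2) hst
      fun x hsx hxt => h x (fun hm => hm.not_lt hsx) (hxt.trans htc)
    linarith
  refine ⟨G, ⟨⟨⟨fun t ht => ⟨_, hleft t ht⟩, ?_, 0, hlim⟩, hleft, fun m hm => ?_⟩, hlim⟩, hcount⟩
  · have hc : {t | (G - H) t ≠ 0}.Countable :=
      hcount.mono fun t (ht : (G - H) t ≠ 0) (e : H t = G t) => ht (by simp [e])
    have := hH.2.1.add (hkIntegrableOn_of_countable (F := G - H) hc)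
    simpa using this
  · have e : G m = 0 := if_pos hm
    rw [e, ← infRight_eq_nhdsGT hI hI' hm]
    exact hlim

/-! ### The derivative of an integrable function -/

/-- Second derivatives of test functions may be integrated against indefinite integrals. -/
lemma IsIndefinite.integrable_mul {f P : ℝ → ℝ} {a b : ℝ} (hP : IsIndefinite f (Icc a b) P)
    {g : ℝ → ℝ} (hg : Continuous g) (h : ∀ x ∉ Icc a b, g x = 0) :
    MeasureTheory.Integrable fun x => P x * g x :=
  ((hP.continuousOn.mul hg.continuousOn).integrableOn_Icc).integrable_of_forall_notMem_eq_zero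
    fun x hx => mul_eq_zero_of_right _ (h x hx)

lemma TestFun.continuous_deriv_deriv (φ : TestFun I) :
    Continuous (deriv (deriv (φ : ℝ → ℝ))) :=
  (TestFun.contDiff_deriv φ).continuous_deriv le_rfl

lemma TestFun.deriv_deriv_eq_zero {φ : TestFun I} {a b : ℝ}
    (h : tsupport (φ : ℝ → ℝ) ⊆ Icc a b) : ∀ x ∉ Icc a b, deriv (deriv (φ : ℝ → ℝ)) x = 0 :=
  fun _ hx => eq_zero_of_notMem
    (tsupport_deriv_subset.trans (tsupport_deriv_subset.trans h)) hx

/-- The second distributional derivative of an indefinite integral on `I`. -/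
noncomputable def secondDeriv (hI : I.OrdConnected) (hI' : I.Nontrivial) {f P : ℝ → ℝ}
    (hP : IsIndefinite f I P) : TestFun I →ₗ[ℝ] ℝ where
  toFun φ := ∫ x, P x * deriv (deriv (φ : ℝ → ℝ)) x
  map_add' φ ψ := by
    have hint : ∀ φ : TestFun I,
        MeasureTheory.Integrable fun x => P x * deriv (deriv (φ : ℝ → ℝ)) x := fun φ => by
      obtain ⟨a, b, hab, h1, h2⟩ := TestFun.exists_Icc hI hI' φ
      exact (hP.mono h2).integrable_mul (TestFun.continuous_deriv_deriv φ)
        (TestFun.deriv_deriv_eq_zero h1)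
    rw [← MeasureTheory.integral_add (hint φ) (hint ψ)]
    congr 1
    ext x
    have e : deriv ((φ + ψ : TestFun I) : ℝ → ℝ) = fun x => deriv (φ : ℝ → ℝ) x +
        deriv (ψ : ℝ → ℝ) x := funext fun x =>
      deriv_add ((TestFun.contDiff φ).differentiable (by simp) x)
        ((TestFun.contDiff ψ).differentiable (by simp) x)
    rw [e, deriv_fun_add ((TestFun.contDiff_deriv φ).differentiable (by simp) x)
      ((TestFun.contDiff_deriv ψ).differentiable (by simp) x), mul_add]
  map_smul' c φ := by
    rw [RingHom.id_apply, smul_eq_mul, ← MeasureTheory.integral_const_mul]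
    congr 1
    ext x
    have e : deriv ((c • φ : TestFun I) : ℝ → ℝ) = fun x => c * deriv (φ : ℝ → ℝ) x :=
      funext fun x => deriv_const_smul c ((TestFun.contDiff φ).differentiable (by simp) x)
    rw [e, deriv_const_mul c ((TestFun.contDiff_deriv φ).differentiable (by simp) x)]
    ring

lemma secondDeriv_mem_Distr (hI : I.OrdConnected) (hI' : I.Nontrivial) {f P : ℝ → ℝ}
    (hP : IsIndefinite f I P) : secondDeriv hI hI' hP ∈ Distr I := by
  rintro u φ ⟨⟨K, hK, hKI, hu⟩, hconv⟩
  obtain ⟨a, b, hab, hKab, hsub⟩ := exists_Icc_subset hI hI' hK hKI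
  -- `TestConverges` confines only the supports of the `u n`; the limit inherits the confinement
  -- pointwise.
  have hφ : tsupport (φ : ℝ → ℝ) ⊆ Icc a b := by
    refine closure_minimal (fun x hx => ?_) isClosed_Icc
    by_contra hn
    refine hx (tendsto_nhds_unique ((hconv 0).tendsto_at x) ?_)
    simp only [iteratedDeriv_zero]
    exact tendsto_const_nhds.congr fun n => (eq_zero_of_notMem ((hu n).trans hKab) hn).symm
  have hc2 : ∀ g : ℝ → ℝ, iteratedDeriv 2 g = deriv (deriv g) := fun g => by
    rw [iteratedDeriv_succ, iteratedDeriv_one]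
  have h2 := hconv 2
  simp only [hc2] at h2
  have hPi := hP.mono hsub
  have hint : ∀ ψ : TestFun I, tsupport (ψ : ℝ → ℝ) ⊆ Icc a b →
      MeasureTheory.Integrable fun x => P x * deriv (deriv (ψ : ℝ → ℝ)) x := fun ψ h =>
    hPi.integrable_mul (TestFun.continuous_deriv_deriv ψ) (TestFun.deriv_deriv_eq_zero h)
  -- The dominating function is valid once the second derivatives differ by less than `1` uniformly.
  refine MeasureTheory.tendsto_integral_filter_of_dominated_convergence
    ((Icc a b).indicator fun x => |P x| * (|deriv (deriv (φ : ℝ → ℝ)) x| + 1))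
    (Eventually.of_forall fun n => (hint _ ((hu n).trans hKab)).aestronglyMeasurable) ?_ ?_ ?_
  · filter_upwards [Metric.tendstoUniformly_iff.1 h2 1 one_pos] with n hn
    refine Eventually.of_forall fun x => ?_
    by_cases hx : x ∈ Icc a b
    · rw [indicator_of_mem hx, norm_mul, Real.norm_eq_abs, Real.norm_eq_abs]
      have := hn x
      rw [Real.dist_eq, abs_sub_comm] at this
      have := abs_sub_abs_le_abs_sub (deriv (deriv (u n : ℝ → ℝ)) x) (deriv (deriv (φ : ℝ → ℝ)) x)
      gcongr
      linarith
    · rw [indicator_of_notMem hx, TestFun.deriv_deriv_eq_zero ((hu n).trans hKab) x hx, mul_zero,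
        norm_zero]
  · rw [MeasureTheory.integrable_indicator_iff measurableSet_Icc]
    exact (hPi.continuousOn.abs.mul ((TestFun.continuous_deriv_deriv φ).abs.add
      continuous_const).continuousOn).integrableOn_Icc
  · exact Eventually.of_forall fun x => (h2.tendsto_at x).const_mul (P x)

/-- Every integrable function is a primitive of a distribution. -/
lemma HKIntegrableOn.exists_isPrimitive (hI : I.OrdConnected) (hI' : I.Nontrivial) {F : I → ℝ}
    (hF : HKIntegrableOn F) : ∃ f ∈ Distr I, IsPrimitive F f := by
  obtain ⟨P, hP', -⟩ := hF.exists_isIndefinite hI'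
  have hP := hP'.mono (subset_hull I)
  refine ⟨secondDeriv hI hI' hP, secondDeriv_mem_Distr hI hI' hP, fun φ a b hab h1 h2 => ?_⟩
  -- Parts with `ψ = φ'`: the boundary terms vanish since `φ'` is continuous with support in `[a,
  -- b]`, leaving `-∫ P φ''`.
  have := (hP.mono h2).hasHKIntegral_mul hab (TestFun.contDiff_deriv φ)
  have hc := (TestFun.contDiff_deriv φ).continuous
  rw [eq_zero_of_notMem_Ioo hc h1 fun h => lt_irrefl _ h.2, eq_zero_of_notMem_Ioo hc h1 fun h => lt_irrefl _ h.1,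
    intervalIntegral_eq_integral hab.le fun x hx => by
      rw [eq_zero_of_notMem (tsupport_deriv_subset.trans h1) hx, mul_zero]] at this
  simpa [secondDeriv] using this

/-! ### The space `𝒜_D(I)` -/

lemma AD.exists_isPrimitive (hI : I.OrdConnected) (hI' : I.Nontrivial) (f : AD I) :
    ∃ F : Dlc0 I, IsPrimitive (F : I → ℝ) (f : TestFun I →ₗ[ℝ] ℝ) := by
  obtain ⟨-, H, hH, h0, hp⟩ := f.2
  obtain ⟨G, hG, hc⟩ := exists_leftContinuous hI hI' hH h0
  exact ⟨⟨G, hG⟩, hp.congr_countable hc⟩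

lemma isPrimitive_prim (hI : I.OrdConnected) (hI' : I.Nontrivial) (f : AD I) :
    IsPrimitive (prim f : I → ℝ) (f : TestFun I →ₗ[ℝ] ℝ) :=
  Classical.epsilon_spec (AD.exists_isPrimitive hI hI' f)

lemma prim_eq (hI : I.OrdConnected) (hI' : I.Nontrivial) {f : AD I} {F : Dlc0 I}
    (hF : IsPrimitive (F : I → ℝ) (f : TestFun I →ₗ[ℝ] ℝ)) : prim f = F :=
  Subtype.ext ((isPrimitive_prim hI hI' f).eq_of_mem_Dlc0 hI hI' hF (prim f).2 F.2)

/-- Primitives in `Dlc I` differ by a constant, which cancels in the increment. -/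
lemma ldIntegral_eq (hI : I.OrdConnected) (hI' : I.Nontrivial) (f : AD I) (G : Dlc I)
    (hG : IsPrimitive (G : I → ℝ) (f : TestFun I →ₗ[ℝ] ℝ)) (a b : I) :
    ldIntegral f a b = (G : I → ℝ) b - (G : I → ℝ) a := by
  have h := Classical.epsilon_spec (p := fun G : Dlc I =>
    IsPrimitive (G : I → ℝ) (f : TestFun I →ₗ[ℝ] ℝ)) ⟨G, hG⟩
  obtain ⟨k, hk⟩ := h.sub_eq_const hI hI' hG (Subtype.prop _) G.2
  have h1 := hk a
  have h2 := hk b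
  simp only [ldIntegral]
  linarith

lemma ldIntegral_eq_prim (hI : I.OrdConnected) (hI' : I.Nontrivial) (f : AD I) (a b : I) :
    ldIntegral f a b = (prim f : I → ℝ) b - (prim f : I → ℝ) a :=
  ldIntegral_eq hI hI' f ⟨_, (prim f).2.1⟩ (isPrimitive_prim hI hI' f) a b

lemma eq_zero_of_isMin (hI : I.OrdConnected) (hI' : I.Nontrivial) {F : I → ℝ} (hF : F ∈ Dlc0 I)
    {m : I} (hm : IsMin m) : F m = 0 := by
  have := infRight_neBot hI hI'
  refine tendsto_nhds_unique ?_ hF.2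
  rw [infRight_eq_nhdsGT hI hI' hm]
  exact hF.1.2.2 m hm

lemma prim_add (hI : I.OrdConnected) (hI' : I.Nontrivial) (f g : AD I) :
    prim (f + g) = prim f + prim g := by
  refine prim_eq hI hI' ?_
  rw [Submodule.coe_add, Submodule.coe_add]
  exact (isPrimitive_prim hI hI' f).add (isPrimitive_prim hI hI' g)

lemma prim_smul (hI : I.OrdConnected) (hI' : I.Nontrivial) (c : ℝ) (f : AD I) :
    prim (c • f) = c • prim f := by
  refine prim_eq hI hI' ?_
  rw [Submodule.coe_smul, Submodule.coe_smul]
  exact (isPrimitive_prim hI hI' f).smul c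

/-- The map `ℱ` as a linear equivalence. -/
noncomputable def primEquiv (hI : I.OrdConnected) (hI' : I.Nontrivial) : AD I ≃ₗ[ℝ] Dlc0 I :=
  LinearEquiv.ofBijective
    { toFun := prim
      map_add' := prim_add hI hI'
      map_smul' := prim_smul hI hI' } <| by
    refine ⟨fun f g h => Subtype.ext ?_, fun F => ?_⟩
    · refine (isPrimitive_prim hI hI' f).unique hI hI' ?_
      rw [show prim f = prim g from h]
      exact isPrimitive_prim hI hI' g
    · obtain ⟨f, hf, hp⟩ := (hkIntegrableOn_of_mem_Dlc F.2.1).exists_isPrimitive hI hI'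
      exact ⟨⟨f, hf, F, F.2.1.1, F.2.2, hp⟩, prim_eq hI hI' hp⟩

@[simp] lemma primEquiv_apply (hI : I.OrdConnected) (hI' : I.Nontrivial) (f : AD I) :
    primEquiv hI hI' f = prim f := rfl

/-! ### Transport of structure and normalization at `inf I` -/

/-- The structure of an ordered normed space is transported by injective linear maps. -/
lemma IsOrderedNormedSpace.comap {E E' : Type*} [AddCommGroup E] [Module ℝ E] [AddCommGroup E']
    [Module ℝ E'] {le : E' → E' → Prop} {N : E' → ℝ} (h : IsOrderedNormedSpace le N)
    (Φ : E ≃ₗ[ℝ] E') : IsOrderedNormedSpace (fun x y => le (Φ x) (Φ y)) fun x => N (Φ x) where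
  le_refl x := h.le_refl _
  le_antisymm x y h1 h2 := Φ.injective (h.le_antisymm _ _ h1 h2)
  le_trans x y z h1 h2 := h.le_trans _ _ _ h1 h2
  add_le_add x y z hxy := by simpa using h.add_le_add _ _ (Φ z) hxy
  smul_le_smul k x y hk hxy := by simpa using h.smul_le_smul k _ _ hk hxy
  norm_nonneg x := h.norm_nonneg _
  norm_eq_zero x := by rw [h.norm_eq_zero, LinearEquiv.map_eq_zero_iff]
  norm_smul k x := by rw [map_smul, h.norm_smul]
  norm_add_le x y := by rw [map_add]; exact h.norm_add_le _ _
  cone_closed x hx := by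
    rw [map_zero]
    refine h.cone_closed _ fun ε hε => ?_
    obtain ⟨y, hy, hlt⟩ := hx ε hε
    rw [map_zero] at hy
    rw [map_sub] at hlt
    exact ⟨Φ y, hy, hlt⟩

/-- If `I` is unbounded below, then an integrable function has no nonzero limit at `-∞`. -/
lemma HKIntegrableOn.limit_nonpos_of_not_bddBelow (hI : I.OrdConnected) (hI' : I.Nontrivial)
    {H : I → ℝ} (hH : HKIntegrableOn H) (hb : ¬ BddBelow I) {l : ℝ}
    (hl : Tendsto H (infRight I) (𝓝 l)) : l ≤ 0 := by
  by_contra! hpos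
  obtain ⟨c, hcm, hc⟩ := (tendsto_infRight_iff hI hI').1 hl (l / 2) (half_pos hpos)
  obtain ⟨d, -, hdc⟩ := exists_not_isMin_lt hI hcm
  -- So far to the left that `(d - a) * (l / 2)`, a lower bound for the integral over `[a, d]`,
  -- exceeds `alexNorm H`.
  obtain ⟨a, haI, ha⟩ := not_bddBelow_iff.1 hb (d - (2 * alexNorm H + 1) / l)
  have hN := alexNorm_nonneg H
  have h0 : 0 ≤ (2 * alexNorm H + 1) / l := by positivity
  have had : a < d := by linarith
  have hsub := hI.out haI d.2
  have h1 := (hasHKIntegral_const (hab := had) (l / 2)).mono (hH.hasHKIntegral had hsub)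
    fun x hx => by
      rw [zeroExt_of_mem H (hsub hx)]
      have hxm : ¬ IsMin (⟨x, hsub hx⟩ : I) := fun hm =>
        hb ⟨x, fun y hy => hm.isBot ⟨y, hy⟩⟩
      have := (abs_lt.1 (hc ⟨x, hsub hx⟩ hxm (lt_of_le_of_lt (show x ≤ d from hx.2) hdc))).1
      linarith
  have h2 := (abs_le.1 (hH.abs_hkIntegral_le hI hI' had hsub)).2
  have h3 : (2 * alexNorm H + 1) / l < d - a := by linarith
  rw [div_lt_iff₀ hpos] at h3
  linarith

/-- If `I` is bounded above or unbounded below, then a primitive in `𝒟^{lr}(I)` may be replaced by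
one with limit zero at `inf I`. -/
lemma mem_AD_of_isPrimitive (hI : I.OrdConnected) (hI' : I.Nontrivial)
    (hb : BddAbove I ∨ ¬ BddBelow I) {f : TestFun I →ₗ[ℝ] ℝ} (hf : f ∈ Distr I) {H : I → ℝ}
    (hH : H ∈ Dlr I) (hp : IsPrimitive H f) : f ∈ AD I := by
  obtain ⟨l, hl⟩ := hH.2.2
  by_cases hbb : BddBelow I
  · have hba : BddAbove I := hb.resolve_right (not_not.2 hbb)
    have hc : (fun _ : I => l) ∈ Dlr I := ⟨fun _ _ => ⟨l, tendsto_const_nhds⟩,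
      hkIntegrableOn_const hI hI' hbb hba l, l, tendsto_const_nhds⟩
    refine ⟨hf, H - fun _ => l, sub_mem hH hc, ?_, ?_⟩
    · have := hl.sub (tendsto_const_nhds (x := l))
      rwa [sub_self] at this
    · simpa using hp.sub (isPrimitive_const l)
  -- Applied to `H` and to `-H`, the one-sided bound forces `l = 0`.
  · have h1 := hH.2.1.limit_nonpos_of_not_bddBelow hI hI' hbb hl
    have h2 := (hH.2.1.smul (-1)).limit_nonpos_of_not_bddBelow hI hI' hbb (l := -1 * l)
      (hl.const_mul (-1))
    obtain rfl : l = 0 := by linarith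
    exact ⟨hf, H, hH, hl, hp⟩

end LDPrimitive

/-! ### The theorem -/

theorem theorem3p5 (I : Set ℝ) (hI : I.OrdConnected) (hI' : I.Nontrivial) :
    -- the Alexiewicz norm is a finite supremum of Henstock–Kurzweil integrals
    (∀ F ∈ Dlc I,
      (∀ (a b : ℝ) (hab : a < b), Icc a b ⊆ I →
        ∃ y : ℝ, HasHKIntegral (zeroExt F) a b hab y) ∧
      IsLUB (alexSet F) (alexNorm F)) ∧
    -- the two spaces of primitives
    IsOrderedNormedSpace
      (fun F G : Dlc I => ∀ x : I, (F : I → ℝ) x ≤ (G : I → ℝ) x)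
      (fun F : Dlc I => alexNorm (F : I → ℝ)) ∧
    IsOrderedNormedSpace
      (fun F G : Dlc0 I => ∀ x : I, (F : I → ℝ) x ≤ (G : I → ℝ) x)
      (fun F : Dlc0 I => alexNorm (F : I → ℝ)) ∧
    -- unless `I` is bounded below and unbounded above, every distribution with a primitive in
    -- `𝒟^{lr}(I)` belongs to `𝒜_D(I)`
    ((BddAbove I ∨ ¬ BddBelow I) → ∀ f ∈ Distr I,
      (∃ H ∈ Dlr I, IsPrimitive H f) → f ∈ AD I) ∧
    -- every `f ∈ 𝒜_D(I)` has exactly one primitive in `𝒟^{lc}_0(I)`, so that `ℱ(f)`, and with it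
    -- the order and the norm of `𝒜_D(I)`, are well defined
    (∀ f : AD I, ∃! F : Dlc0 I,
      IsPrimitive (F : I → ℝ) (f : TestFun I →ₗ[ℝ] ℝ)) ∧
    (∀ f : AD I, IsPrimitive
      (prim f : I → ℝ) (f : TestFun I →ₗ[ℝ] ℝ)) ∧
    -- the integral does not depend on the primitive
    (∀ (f : AD I) (G : Dlc I),
      IsPrimitive (G : I → ℝ) (f : TestFun I →ₗ[ℝ] ℝ) →
      ∀ a b : I, ldIntegral f a b = (G : I → ℝ) b - (G : I → ℝ) a) ∧
    -- `𝒜_D(I)` is an ordered normed space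
    IsOrderedNormedSpace
      (ADle : AD I → AD I → Prop) ADnorm ∧
    (∀ m : I, IsMin m → ∀ f g : AD I, ADle f g ↔
      ∀ x : I, ldIntegral f m x ≤ ldIntegral g m x) ∧
    -- `ℱ` is an isometric linear order isomorphism from `𝒜_D(I)` onto `𝒟^{lc}_0(I)`, and it is
    -- given by the integral
    (∃ Φ : AD I ≃ₗ[ℝ] Dlc0 I,
      (∀ f, Φ f = prim f) ∧
      (∀ f, alexNorm (Φ f : I → ℝ) = ADnorm f) ∧
      (∀ f g, ADle f g ↔ ∀ x : I, (Φ f : I → ℝ) x ≤ (Φ g : I → ℝ) x) ∧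
      (∀ f (x : I), Tendsto (fun a : I => ldIntegral f a x)
        (infRight I) (𝓝 ((Φ f : I → ℝ) x))) ∧
      (∀ m : I, IsMin m → ∀ f (x : I), (Φ f : I → ℝ) x = ldIntegral f m x)) := by
  have hD0 := isOrderedNormedSpace_of_le_Dlc hI hI' (S := Dlc0 I) fun F hF => hF.1
  have hA : IsOrderedNormedSpace (ADle : AD I → AD I → Prop) ADnorm := by
    have h := hD0.comap (E := AD I) (primEquiv hI hI')
    simp only [primEquiv_apply] at h
    exact h
  refine ⟨fun F hF => ⟨fun a b hab h =>
    ⟨_, (hkIntegrableOn_of_mem_Dlc hF).hasHKIntegral hab h⟩,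
      (hkIntegrableOn_of_mem_Dlc hF).isLUB_alexNorm hI hI'⟩,
    isOrderedNormedSpace_of_le_Dlc hI hI' le_rfl, hD0,
    fun hb f hf ⟨H, hH, hp⟩ => mem_AD_of_isPrimitive hI hI' hb hf hH hp,
    fun f => ⟨prim f, isPrimitive_prim hI hI' f, fun F hF => (prim_eq hI hI' hF).symm⟩,
    isPrimitive_prim hI hI', ldIntegral_eq hI hI', hA,
    fun m hm f g => ?_, primEquiv hI hI', fun _ => rfl, fun _ => rfl, fun _ _ => Iff.rfl,
    fun f x => ?_, fun m hm f x => ?_⟩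
  · simp only [ldIntegral_eq_prim hI hI', eq_zero_of_isMin hI hI' (prim f).2 hm,
      eq_zero_of_isMin hI hI' (prim g).2 hm, sub_zero, ADle]
  · simp only [ldIntegral_eq_prim hI hI', primEquiv_apply]
    simpa using (prim f).2.2.const_sub ((prim f : I → ℝ) x)
  · rw [ldIntegral_eq_prim hI hI', eq_zero_of_isMin hI hI' (prim f).2 hm, sub_zero,
      primEquiv_apply]
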